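/- **Setting.** Let $d\in\{2,3\}$ and let $\Omega\subset\mathbb R^d$ be a polygonal/polyhedral domain (open, connected) whose closure is triangulated by a conforming simplicial mesh $\mathcal T_h$ with set of edges ($d=2$) or faces ($d=3$) $\mathcal E_h$ and mesh size $h=\max_{K\in\mathcal T_h}\operatorname{diam}K$. The mesh is shape-regular with constant $\sigma$ (each $K$ contains a ball of diameter at least $\operatorname{diam}(K)/\sigma$) and quasi-uniform with constant $\tau$ ($h\le\tau\operatorname{diam}K$ for all $K$). Let $\mathbb A$ be a symmetric diffusion matrix with $\alpha|\xi|^2\le\xi^T\mathbb A(x)\xi\le\beta|\xi|^2$ for all $x\in\Omega$, $\xi\in\mathbb R^d$, where $\alpha,\beta>0$. Fix $j\ge 0$ and one of the two pairs: (RT) $l=j$, $G_j=[P_j]^d+\widehat P_j\,\mathbf x$, where $\widehat P_j$ are the homogeneous polynomials of degree $j$; or (BDM) $l=j+1$, $G_j=[P_{j+1}]^d$. Let $V_h$ be the space of weak functions $v=\{v_0,v_b\}$ with $v_0|_K\in P_j(K)$ for $K\in\mathcal T_h$, $v_b|_e\in P_l(e)$ for $e\in\mathcal E_h$, and $v_b|_e=0$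 if $e\subset\partial\Omega$. The weak gradient $\nabla_wv|_K\in G_j$ is defined by $$(\nabla_wv,\mathbf q)_K=-(v_0,\nabla\cdot\mathbf q)_K+\langle v_b,\mathbf q\cdot\mathbf n\rangle_{\partial K}\qquad\text{for all }\mathbf q\in G_j,$$ with $\mathbf n$ the outward unit normal. Put $a_h(u,v)=\sum_K(\mathbb A\nabla_wu,\nabla_wv)_K$ and $$((v,w))=\sum_{K\in\mathcal T_h}\big[(v_0,w_0)_K+h\,(v_0-v_b,w_0-w_b)_{\partial K}\big].$$ Let $V_0=\{\{v_0,0\}\in V_h\}$, $V_b=\{\{0,v_b\}\in V_h\}$, let $P_0:V_b\to V_0$ be the linear map with $a_h(P_0v_b,\zeta)=a_h(v_b,\zeta)$ for all $\zeta\in V_0$, let $V_r=(I-P_0)V_b\subset V_h$, and let the reduced operator $A_r:V_r\to V_r$ be the linear map with $((A_ru,v))=a_h(u,v)$ for all $u,v\in V_r$. **Lemma.** For given $d$, $j$, pair (RT or BDM), $\alpha,\beta,\sigma,\tau>0$ there are constants $c,C>0$, depending only on these data, such that for every such $\Omega$, $\mathcal T_h$, $\mathbb A$, if $\mathbb A$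 is constant on the interior of each element of $\mathcal T_h$ and $\mathcal T_h$ has at least one interior vertex (a vertex not on $\partial\Omega$), then $P_0$ and $A_r$ exist and are unique, and the spectral radius $\rho_{A_r}$ of $A_r$ is of order $h^{-2}$: $$c\,h^{-2}\le\rho_{A_r}\le C\,h^{-2}.$$ -/

import Mathlib

open MeasureTheory
open scoped BigOperators

noncomputable section

namespace WeakGalerkin

/-! ### Polynomials -/

/-- Value of a polynomial in `d` variables at a point of `ℝ^d`. -/
def pval {d : ℕ} (p : MvPolynomial (Fin d) ℝ) (x : EuclideanSpace ℝ (Fin d)) : ℝ :=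
  MvPolynomial.eval (fun i => x i) p

/-- Restriction of polynomials to functions on a set `S ⊆ ℝ^d`. -/
def restrictTo {d : ℕ} (S : Set (EuclideanSpace ℝ (Fin d))) :
    MvPolynomial (Fin d) ℝ →ₗ[ℝ] (S → ℝ) where
  toFun p x := pval p x
  map_add' p q := by ext x; simp [pval]
  map_smul' c p := by ext x; simp [pval]

/-- `P_k(S)`: the functions on `S` that are polynomials of degree at most `k`. -/
def polyOn {d : ℕ} (k : ℕ) (S : Set (EuclideanSpace ℝ (Fin d))) : Submodule ℝ (S → ℝ) :=
  (MvPolynomial.restrictTotalDegree (Fin d) ℝ k).map (restrictTo S)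

/-- The two pairs of discrete spaces: `RT` is `W_{j,j}` with Raviart-Thomas weak gradients, `BDM` is
`W_{j,j+1}` with Brezzi-Douglas-Marini weak gradients. -/
inductive Pair where
  | RT
  | BDM

/-- The polynomial degree `l` on edges/faces: `l = j` for RT and `l = j + 1` for BDM. -/
def Pair.faceDegree : Pair → ℕ → ℕ
  | .RT, j => j
  | .BDM, j => j + 1

/-- The local space `G_j` of polynomial vector fields: `[P_j]^d + P̂_j x` (where `P̂_j` are the
homogeneous polynomials of degree `j`) for RT, `[P_{j+1}]^d` for BDM. -/
def Pair.gradSpace (π : Pair) (d j : ℕ) : Submodule ℝ (Fin d → MvPolynomial (Fin d) ℝ) :=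
  match π with
  | .RT => Submodule.pi Set.univ (fun _ => MvPolynomial.restrictTotalDegree (Fin d) ℝ j) ⊔
      (MvPolynomial.homogeneousSubmodule (Fin d) ℝ j).map
        (LinearMap.pi fun i => LinearMap.mulRight ℝ (MvPolynomial.X i))
  | .BDM => Submodule.pi Set.univ (fun _ => MvPolynomial.restrictTotalDegree (Fin d) ℝ (j + 1))

/-- Divergence of a polynomial vector field. -/
def divergence {d : ℕ} : (Fin d → MvPolynomial (Fin d) ℝ) →ₗ[ℝ] MvPolynomial (Fin d) ℝ :=
  ∑ i, (MvPolynomial.pderiv i).toLinearMap ∘ₗ LinearMap.proj i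

/-! ### Meshes -/

/-- A conforming simplicial mesh of (the closure of) `Ω ⊆ ℝ^d`. -/
structure Mesh {d : ℕ} (Ω : Set (EuclideanSpace ℝ (Fin d))) extends
    Geometry.SimplicialComplex ℝ (EuclideanSpace ℝ (Fin d)) where
  finite_faces : faces.Finite
  space_eq : toSimplicialComplex.space = closure Ω

/-- The closed simplex with the given vertices. -/
abbrev hull {d : ℕ} (s : Finset (EuclideanSpace ℝ (Fin d))) : Set (EuclideanSpace ℝ (Fin d)) :=
  convexHull ℝ (s : Set (EuclideanSpace ℝ (Fin d)))

/-- The outward unit normal of the simplex `K` on its face `e`: the component orthogonal to `e` of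
the vector from the centroid of `K` to the centroid of `e`, normalized. -/
def outerNormal {d : ℕ} (K e : Finset (EuclideanSpace ℝ (Fin d))) : EuclideanSpace ℝ (Fin d) :=
  let w := (vectorSpan ℝ (e : Set (EuclideanSpace ℝ (Fin d))))ᗮ.starProjection
    (e.centroid ℝ id - K.centroid ℝ id)
  ‖w‖⁻¹ • w

variable {d : ℕ} {Ω : Set (EuclideanSpace ℝ (Fin d))}

namespace Mesh

/-- The elements of the mesh: triangles (`d = 2`) or tetrahedra (`d = 3`). -/
abbrev Cell (T : Mesh Ω) : Type := {s : Finset (EuclideanSpace ℝ (Fin d)) //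
  s ∈ T.faces ∧ s.card = d + 1}

/-- The edges (`d = 2`) or faces (`d = 3`) of the mesh. -/
abbrev Face (T : Mesh Ω) : Type := {s : Finset (EuclideanSpace ℝ (Fin d)) //
  s ∈ T.faces ∧ s.card = d}

instance (T : Mesh Ω) : Finite T.Cell :=
  (T.finite_faces.subset fun _ h => h.1 :
    {s : Finset (EuclideanSpace ℝ (Fin d)) | s ∈ T.faces ∧ s.card = d + 1}.Finite)

instance (T : Mesh Ω) : Finite T.Face :=
  (T.finite_faces.subset fun _ h => h.1 :
    {s : Finset (EuclideanSpace ℝ (Fin d)) | s ∈ T.faces ∧ s.card = d}.Finite)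

instance (T : Mesh Ω) : Fintype T.Cell := Fintype.ofFinite _

instance (T : Mesh Ω) : Fintype T.Face := Fintype.ofFinite _

open Classical in
/-- The edges/faces that make up `∂K`. -/
def bdry (T : Mesh Ω) (K : T.Cell) : Finset T.Face :=
  Finset.univ.filter fun e => e.1 ⊆ K.1

/-- The mesh size `h`: the largest diameter of an element. -/
def size (T : Mesh Ω) : ℝ := ⨆ K : T.Cell, Metric.diam (hull K.1)

/-- Shape regularity: the diameter of each element is at most `σ` times the diameter of some ball
contained in it. -/
def ShapeRegular (T : Mesh Ω) (σ : ℝ) : Prop :=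
  ∀ K : T.Cell, ∃ (x : EuclideanSpace ℝ (Fin d)) (r : ℝ), 0 < r ∧
    Metric.closedBall x r ⊆ hull K.1 ∧ Metric.diam (hull K.1) ≤ σ * (2 * r)

/-- Quasi-uniformity: `h ≤ τ · diam K` for each element `K`. -/
def QuasiUniform (T : Mesh Ω) (τ : ℝ) : Prop :=
  ∀ K : T.Cell, T.size ≤ τ * Metric.diam (hull K.1)

/-- The mesh has a vertex that does not lie on `∂Ω`. -/
def HasInteriorVertex (T : Mesh Ω) : Prop := ∃ p ∈ T.vertices, p ∉ frontier Ω

/-! ### Weak functions -/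

/-- Weak functions `v = {v_0, v_b}`: a polynomial of degree at most `j` on each element, and a
polynomial function of degree at most `l` on each edge/face. -/
def WeakFun (T : Mesh Ω) (π : Pair) (j : ℕ) : Type :=
  (T.Cell → MvPolynomial.restrictTotalDegree (Fin d) ℝ j) ×
    (∀ e : T.Face, polyOn (π.faceDegree j) (hull e.1))

instance (T : Mesh Ω) (π : Pair) (j : ℕ) : AddCommGroup (T.WeakFun π j) :=
  inferInstanceAs (AddCommGroup ((T.Cell → MvPolynomial.restrictTotalDegree (Fin d) ℝ j) ×
    (∀ e : T.Face, polyOn (π.faceDegree j) (hull e.1))))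

instance (T : Mesh Ω) (π : Pair) (j : ℕ) : Module ℝ (T.WeakFun π j) :=
  inferInstanceAs (Module ℝ ((T.Cell → MvPolynomial.restrictTotalDegree (Fin d) ℝ j) ×
    (∀ e : T.Face, polyOn (π.faceDegree j) (hull e.1))))

/-- The component `v_0` of `v = {v_0, v_b}` on the element `K`. -/
def cellPart {T : Mesh Ω} {π : Pair} {j : ℕ} (K : T.Cell) :
    T.WeakFun π j →ₗ[ℝ] MvPolynomial (Fin d) ℝ where
  toFun v := v.1 K
  map_add' _ _ := rfl
  map_smul' _ _ := rfl

/-- The component `v_b` of `v = {v_0, v_b}` on the edge/face `e`. -/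
def facePart {T : Mesh Ω} {π : Pair} {j : ℕ} (e : T.Face) :
    T.WeakFun π j →ₗ[ℝ] polyOn (π.faceDegree j) (hull e.1) where
  toFun v := v.2 e
  map_add' _ _ := rfl
  map_smul' _ _ := rfl

/-- `V_h`: weak functions with `v_b = 0` on the edges/faces contained in `∂Ω`. -/
def Vh (T : Mesh Ω) (π : Pair) (j : ℕ) : Submodule ℝ (T.WeakFun π j) where
  carrier := {v | ∀ e : T.Face, hull e.1 ⊆ frontier Ω → facePart e v = 0}
  add_mem' {u v} hu hv e he := by rw [map_add, hu e he, hv e he, add_zero]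
  zero_mem' e _ := map_zero _
  smul_mem' c v hv e he := by rw [map_smul, hv e he, smul_zero]

/-- `V_0 = {{v_0, 0} ∈ V_h}`. -/
def V0 (T : Mesh Ω) (π : Pair) (j : ℕ) : Submodule ℝ (T.WeakFun π j) :=
  T.Vh π j ⊓ ⨅ e : T.Face, LinearMap.ker (facePart e)

/-- `V_b = {{0, v_b} ∈ V_h}`. -/
def Vb (T : Mesh Ω) (π : Pair) (j : ℕ) : Submodule ℝ (T.WeakFun π j) :=
  T.Vh π j ⊓ ⨅ K : T.Cell, LinearMap.ker (cellPart K)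

/-- The discrete `L²` inner product
`((v, w)) = ∑_K [(v_0, w_0)_K + h (v_0 - v_b, w_0 - w_b)_{∂K}]`. Here `μHE[d - 1]` is the surface
measure (length or area) on an edge/face. -/
def discreteInner (T : Mesh Ω) {π : Pair} {j : ℕ} (v w : T.WeakFun π j) : ℝ :=
  ∑ K : T.Cell, ((∫ x in hull K.1, pval (cellPart K v) x * pval (cellPart K w) x) +
    T.size * ∑ e ∈ T.bdry K, ∫ x : hull e.1,
      (pval (cellPart K v) x - (facePart e v).1 x) *
        (pval (cellPart K w) x - (facePart e w).1 x) ∂μHE[d - 1])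

end Mesh

/-! ### The discrete weak gradient -/

lemma continuous_pval (p : MvPolynomial (Fin d) ℝ) : Continuous (pval p) := by
  unfold pval
  exact (MvPolynomial.continuous_eval p).comp (by fun_prop)

lemma isCompact_hull (s : Finset (EuclideanSpace ℝ (Fin d))) : IsCompact (hull s) :=
  s.finite_toSet.isCompact_convexHull (𝕜 := ℝ)

lemma integrableOn_hull (s : Finset (EuclideanSpace ℝ (Fin d)))
    {f : EuclideanSpace ℝ (Fin d) → ℝ} (hf : Continuous f) : IntegrableOn f (hull s) :=
  hf.continuousOn.integrableOn_compact (isCompact_hull s)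

lemma integrable_mul_hull (s : Finset (EuclideanSpace ℝ (Fin d))) (p q : MvPolynomial (Fin d) ℝ) :
    IntegrableOn (fun x => pval p x * pval q x) (hull s) :=
  integrableOn_hull s ((continuous_pval p).mul (continuous_pval q))

/-- The surface measure of an edge/face is finite. -/
instance finite_surface (T : Mesh Ω) (e : T.Face) :
    IsFiniteMeasure (μHE[d - 1] : Measure (hull e.1)) := by
  have hne : e.1.Nonempty := T.nonempty_of_mem_faces e.2.1
  have hcard := e.2.2
  obtain ⟨p, hp⟩ := hne
  have hpos : 0 < d := hcard ▸ Finset.card_pos.2 ⟨p, hp⟩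
  let A : AffineSubspace ℝ (EuclideanSpace ℝ (Fin d)) := affineSpan ℝ (e.1 : Set _)
  let pA : A := ⟨p, subset_affineSpan ℝ _ (Finset.mem_coe.2 hp)⟩
  have : Nonempty A := ⟨pA⟩
  have hrank : Module.finrank ℝ A.direction = d - 1 := by
    have h1 := (T.indep e.2.1).finrank_vectorSpan (n := d - 1) (by simp; omega)
    rw [Subtype.range_coe_subtype] at h1
    rwa [direction_affineSpan]
  have hsub : hull e.1 ⊆ (A : Set (EuclideanSpace ℝ (Fin d))) := convexHull_subset_affineSpan _
  constructor
  have himg : (Subtype.val '' (Set.univ : Set (hull e.1))) = hull e.1 := by simp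
  rw [← isometry_subtype_coe.euclideanHausdorffMeasure_image, himg]
  have hcl : IsClosed (A : Set (EuclideanSpace ℝ (Fin d))) := A.closed_of_finiteDimensional
  have hc : IsCompact ((Subtype.val : A → EuclideanSpace ℝ (Fin d)) ⁻¹' hull e.1) :=
    hcl.isClosedEmbedding_subtypeVal.isCompact_preimage (isCompact_hull _)
  have himg2 : (Subtype.val '' ((Subtype.val : A → EuclideanSpace ℝ (Fin d)) ⁻¹' hull e.1)) =
      hull e.1 := by
    exact (Subtype.image_preimage_coe _ _).trans (Set.inter_eq_right.2 hsub)
  rw [← himg2, isometry_subtype_coe.euclideanHausdorffMeasure_image, ← hrank,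
    EuclideanGeometry.euclideanHausdorffMeasure_eq pA,
    Measure.map_apply (IsometryEquiv.vaddConst pA).continuous.measurable hc.measurableSet]
  have : IsCompact ((IsometryEquiv.vaddConst pA) ⁻¹'
      ((Subtype.val : A → EuclideanSpace ℝ (Fin d)) ⁻¹' hull e.1)) :=
    (IsometryEquiv.vaddConst pA).toHomeomorph.isCompact_preimage.2 hc
  exact this.measure_lt_top

lemma integrable_face (T : Mesh Ω) (e : T.Face) {f : hull e.1 → ℝ} (hf : Continuous f) :
    Integrable f μHE[d - 1] := by
  have : CompactSpace (hull e.1) := isCompact_iff_compactSpace.1 (isCompact_hull e.1)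
  exact hf.integrable_of_hasCompactSupport (HasCompactSupport.of_compactSpace f)

lemma continuous_of_mem_polyOn {k : ℕ} {S : Set (EuclideanSpace ℝ (Fin d))} (f : polyOn k S) :
    Continuous (f : S → ℝ) := by
  obtain ⟨_, p, -, rfl⟩ := f
  exact (continuous_pval p).comp continuous_subtype_val

/-- Value of a polynomial vector field at a point. -/
def fval (q : Fin d → MvPolynomial (Fin d) ℝ) (x : EuclideanSpace ℝ (Fin d)) : Fin d → ℝ :=
  fun i => pval (q i) x

lemma continuous_fval (q : Fin d → MvPolynomial (Fin d) ℝ) : Continuous (fval q) :=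
  continuous_pi fun i => continuous_pval (q i)

lemma pval_add (p q : MvPolynomial (Fin d) ℝ) (x) : pval (p + q) x = pval p x + pval q x := by
  simp [pval]

lemma pval_smul (c : ℝ) (p : MvPolynomial (Fin d) ℝ) (x) : pval (c • p) x = c * pval p x := by
  simp [pval]

lemma fval_add (p q : Fin d → MvPolynomial (Fin d) ℝ) (x) :
    fval (p + q) x = fval p x + fval q x := by
  ext i; simp [fval, pval_add]

lemma fval_smul (c : ℝ) (p : Fin d → MvPolynomial (Fin d) ℝ) (x) :
    fval (c • p) x = c • fval p x := by
  ext i; simp [fval, pval_smul]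

/-- A simplex of full dimension has non-empty interior. -/
lemma interior_hull_nonempty (T : Mesh Ω) (K : T.Cell) : (interior (hull K.1)).Nonempty := by
  rw [interior_convexHull_nonempty_iff_affineSpan_eq_top]
  have h := (T.indep K.2.1).affineSpan_eq_top_iff_card_eq_finrank_add_one
  rw [Subtype.range_coe_subtype] at h
  exact h.2 (by simp [K.2.2])

/-- A polynomial that vanishes on a full-dimensional simplex is zero. -/
lemma eq_zero_of_vanish (T : Mesh Ω) (K : T.Cell) (p : MvPolynomial (Fin d) ℝ)
    (h : ∀ x ∈ interior (hull K.1), pval p x = 0) : p = 0 := by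
  obtain ⟨y, hy⟩ := interior_hull_nonempty T K
  let g : (Fin d → ℝ) → EuclideanSpace ℝ (Fin d) := WithLp.toLp 2
  have hg : Continuous g := PiLp.continuous_toLp 2 _
  have hU : IsOpen (g ⁻¹' interior (hull K.1)) := isOpen_interior.preimage hg
  have hyU : (fun i => y i) ∈ g ⁻¹' interior (hull K.1) := hy
  obtain ⟨ε, hε, hb⟩ := Metric.isOpen_iff.1 hU _ hyU
  refine MvPolynomial.funext_set (fun i => Metric.ball (y i) ε) (fun i => ?_) fun x hx => ?_
  · rw [Real.ball_eq_Ioo]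
    exact Set.Ioo_infinite (by linarith)
  · have hx' : x ∈ Metric.ball (fun i => y i) ε := by
      rw [ball_pi _ hε]; exact hx
    have := h _ (hb hx')
    simpa [pval, g] using this

/-- `(p, q)_K` for vector fields `p, q` in `G_j(K)`. -/
def cellForm (T : Mesh Ω) (π : Pair) (j : ℕ) (K : T.Cell) :
    π.gradSpace d j →ₗ[ℝ] π.gradSpace d j →ₗ[ℝ] ℝ :=
  LinearMap.mk₂ ℝ (fun p q => ∫ x in hull K.1, fval p.1 x ⬝ᵥ fval q.1 x)
    (fun p p' q => by
      rw [← integral_add]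
      · simp [fval_add, add_dotProduct]
      · exact integrableOn_hull _ (by simpa using (continuous_fval _).dotProduct (continuous_fval _))
      · exact integrableOn_hull _ (by simpa using (continuous_fval _).dotProduct (continuous_fval _)))
    (fun c p q => by
      rw [smul_eq_mul, ← integral_const_mul]
      simp [fval_smul, smul_dotProduct])
    (fun p q q' => by
      rw [← integral_add]
      · simp [fval_add, dotProduct_add]
      · exact integrableOn_hull _ (by simpa using (continuous_fval _).dotProduct (continuous_fval _))
      · exact integrableOn_hull _ (by simpa using (continuous_fval _).dotProduct (continuous_fval _)))
    (fun c p q => by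
      rw [smul_eq_mul, ← integral_const_mul]
      simp [fval_smul, dotProduct_smul])

lemma cellForm_injective (T : Mesh Ω) (π : Pair) (j : ℕ) (K : T.Cell) :
    Function.Injective (cellForm T π j K) := by
  rw [injective_iff_map_eq_zero]
  intro p hp
  have h0 : ∫ x in hull K.1, fval p.1 x ⬝ᵥ fval p.1 x = 0 := by
    simpa [cellForm] using LinearMap.congr_fun hp p
  have hcont : Continuous fun x => fval p.1 x ⬝ᵥ fval p.1 x :=
    (continuous_fval _).dotProduct (continuous_fval _)
  have hnn : ∀ x, 0 ≤ fval p.1 x ⬝ᵥ fval p.1 x := fun x =>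
    Finset.sum_nonneg fun i _ => mul_self_nonneg _
  rw [integral_eq_zero_iff_of_nonneg hnn (integrableOn_hull _ hcont)] at h0
  have h1 : (fun x => fval p.1 x ⬝ᵥ fval p.1 x) =ᵐ[volume.restrict (interior (hull K.1))] 0 :=
    ae_restrict_of_ae_restrict_of_subset interior_subset h0
  have h2 := Measure.eqOn_open_of_ae_eq h1 isOpen_interior hcont.continuousOn continuousOn_const
  ext1
  funext i
  refine eq_zero_of_vanish T K _ fun x hx => ?_
  have := h2 hx
  exact congr_fun (dotProduct_self_eq_zero.1 this) i

instance finite_gradSpace (π : Pair) (j : ℕ) : FiniteDimensional ℝ (π.gradSpace d j) := by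
  have hpi (k : ℕ) : FiniteDimensional ℝ (Submodule.pi Set.univ
      (fun _ : Fin d => MvPolynomial.restrictTotalDegree (Fin d) ℝ k)) := by
    let f : Submodule.pi Set.univ
        (fun _ : Fin d => MvPolynomial.restrictTotalDegree (Fin d) ℝ k) →ₗ[ℝ]
        (Fin d → MvPolynomial.restrictTotalDegree (Fin d) ℝ k) :=
      LinearMap.pi fun i => ((LinearMap.proj i).comp (Submodule.subtype _)).codRestrict _
        fun q => q.2 i (Set.mem_univ i)
    refine FiniteDimensional.of_injective f fun p q h => ?_
    ext1
    funext i
    exact congrArg Subtype.val (congr_fun h i)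
  have hhom : FiniteDimensional ℝ (MvPolynomial.homogeneousSubmodule (Fin d) ℝ j) :=
    Submodule.finiteDimensional_of_le (S₂ := MvPolynomial.restrictTotalDegree (Fin d) ℝ j)
      fun p hp => (MvPolynomial.mem_restrictTotalDegree _ _ _).2
        ((MvPolynomial.mem_homogeneousSubmodule _ _).1 hp).totalDegree_le
  cases π
  · have := hpi j
    exact Submodule.finiteDimensional_sup _ _
  · exact hpi (j + 1)

lemma integrable_flux (T : Mesh Ω) {k : ℕ} (e : T.Face) (f : polyOn k (hull e.1))
    (q : Fin d → MvPolynomial (Fin d) ℝ) (n : EuclideanSpace ℝ (Fin d)) :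
    Integrable (fun x : hull e.1 => f.1 x * (fval q x ⬝ᵥ n)) μHE[d - 1] :=
  integrable_face T e ((continuous_of_mem_polyOn f).mul
    (((continuous_fval q).comp continuous_subtype_val).dotProduct continuous_const))

/-- Riesz isomorphism of `G_j(K)` with its dual, for the `L²(K)` inner product. -/
def rieszEquiv (T : Mesh Ω) (π : Pair) (j : ℕ) (K : T.Cell) :
    π.gradSpace d j ≃ₗ[ℝ] Module.Dual ℝ (π.gradSpace d j) :=
  (cellForm T π j K).linearEquivOfInjective (cellForm_injective T π j K)
    Subspace.dual_finrank_eq.symm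

/-- The right-hand side `-(v_0, ∇ · q)_K + ⟨v_b, q · n⟩_{∂K}` in the definition of the weak
gradient. -/
def weakGradRhs (T : Mesh Ω) (π : Pair) (j : ℕ) (K : T.Cell) :
    T.WeakFun π j →ₗ[ℝ] Module.Dual ℝ (π.gradSpace d j) :=
  LinearMap.mk₂ ℝ (fun v q =>
    -(∫ x in hull K.1, pval (Mesh.cellPart K v) x * pval (divergence q.1) x) +
      ∑ e ∈ T.bdry K, ∫ x : hull e.1, (Mesh.facePart e v).1 x *
        (fval q.1 x ⬝ᵥ outerNormal K.1 e.1) ∂μHE[d - 1])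
    (fun v v' q => by
      simp only [map_add, Pi.add_apply, Submodule.coe_add, pval_add, add_mul]
      rw [integral_add (integrable_mul_hull _ _ _)
        (integrable_mul_hull _ _ _)]
      simp_rw [integral_add (integrable_flux T _ (Mesh.facePart _ v) q.1 _)
        (integrable_flux T _ (Mesh.facePart _ v') q.1 _), Finset.sum_add_distrib]
      ring)
    (fun c v q => by
      simp only [map_smul, Pi.smul_apply, Submodule.coe_smul, pval_smul,
        smul_eq_mul, mul_assoc, integral_const_mul, ← Finset.mul_sum]
      ring)
    (fun v q q' => by
      simp only [Submodule.coe_add, map_add, pval_add, fval_add, mul_add, add_dotProduct]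
      rw [integral_add (integrable_mul_hull _ _ _)
        (integrable_mul_hull _ _ _)]
      simp_rw [integral_add (integrable_flux T _ (Mesh.facePart _ v) q.1 _)
        (integrable_flux T _ (Mesh.facePart _ v) q'.1 _), Finset.sum_add_distrib]
      ring)
    (fun c v q => by
      simp only [Submodule.coe_smul, map_smul, pval_smul, fval_smul, smul_dotProduct,
        smul_eq_mul, mul_left_comm _ c, integral_const_mul, ← Finset.mul_sum]
      ring)

/-- The discrete weak gradient on the element `K`: the unique `∇_w v ∈ G_j(K)` such that
`(∇_w v, q)_K = -(v_0, ∇ · q)_K + ⟨v_b, q · n⟩_{∂K}` for all `q ∈ G_j(K)`. -/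
def weakGrad (T : Mesh Ω) (π : Pair) (j : ℕ) (K : T.Cell) :
    T.WeakFun π j →ₗ[ℝ] π.gradSpace d j :=
  (rieszEquiv T π j K).symm.toLinearMap ∘ₗ weakGradRhs T π j K

theorem weakGrad_spec (T : Mesh Ω) (π : Pair) (j : ℕ) (K : T.Cell) (v : T.WeakFun π j)
    (q : π.gradSpace d j) :
    (∫ x in hull K.1, fval (weakGrad T π j K v).1 x ⬝ᵥ fval q.1 x) =
      -(∫ x in hull K.1, pval (Mesh.cellPart K v) x * pval (divergence q.1) x) +
        ∑ e ∈ T.bdry K, ∫ x : hull e.1, (Mesh.facePart e v).1 x *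
          (fval q.1 x ⬝ᵥ outerNormal K.1 e.1) ∂μHE[d - 1] :=
  LinearMap.congr_fun ((rieszEquiv T π j K).apply_symm_apply (weakGradRhs T π j K v)) q

/-! ### The bilinear form and the reduced operator -/

/-- The diffusion matrix is symmetric with `α |ξ|² ≤ ξᵀ 𝔸(x) ξ ≤ β |ξ|²` for `x ∈ Ω`. -/
def IsDiffusion (Ω : Set (EuclideanSpace ℝ (Fin d))) (α β : ℝ)
    (𝔸 : EuclideanSpace ℝ (Fin d) → Matrix (Fin d) (Fin d) ℝ) : Prop :=
  ∀ x ∈ Ω, (𝔸 x).IsSymm ∧ ∀ ξ : Fin d → ℝ,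
    α * (ξ ⬝ᵥ ξ) ≤ ξ ⬝ᵥ (𝔸 x).mulVec ξ ∧ ξ ⬝ᵥ (𝔸 x).mulVec ξ ≤ β * (ξ ⬝ᵥ ξ)

namespace Mesh

/-- `𝔸` is constant on (the interior of) each element. -/
def IsPiecewiseConstant (T : Mesh Ω)
    (𝔸 : EuclideanSpace ℝ (Fin d) → Matrix (Fin d) (Fin d) ℝ) : Prop :=
  ∀ K : T.Cell, ∃ B : Matrix (Fin d) (Fin d) ℝ, ∀ x ∈ interior (hull K.1), 𝔸 x = B

variable (T : Mesh Ω) (π : Pair) (j : ℕ)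
  (𝔸 : EuclideanSpace ℝ (Fin d) → Matrix (Fin d) (Fin d) ℝ)

/-- `a_h(u, v) = (𝔸 ∇_w u, ∇_w v)`. -/
def energyForm (u v : T.WeakFun π j) : ℝ :=
  ∑ K : T.Cell, ∫ x in hull K.1,
    (𝔸 x).mulVec (fval (weakGrad T π j K u).1 x) ⬝ᵥ fval (weakGrad T π j K v).1 x

/-- `P` is the `a_h`-orthogonal projector from `V_b` to `V_0`:
`a_h(P v_b, ζ) = a_h(v_b, ζ)` for all `ζ ∈ V_0`. -/
def IsEnergyProjector (P : T.Vb π j →ₗ[ℝ] T.V0 π j) : Prop :=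
  ∀ (v : T.Vb π j) (ζ : T.V0 π j),
    T.energyForm π j 𝔸 (P v : T.WeakFun π j) ζ = T.energyForm π j 𝔸 (v : T.WeakFun π j) ζ

open Classical in
/-- The projector `P_0 : V_b → V_0`. -/
def P0 : T.Vb π j →ₗ[ℝ] T.V0 π j :=
  if h : ∃ P, T.IsEnergyProjector π j 𝔸 P then h.choose else 0

/-- `V_r = {(I - P_0) v_b = {-P_0 v_b, v_b} | v_b ∈ V_b}`. -/
def Vr : Submodule ℝ (T.WeakFun π j) :=
  LinearMap.range ((T.Vb π j).subtype - (T.V0 π j).subtype ∘ₗ T.P0 π j 𝔸)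

/-- `B` is the operator on `V_r` with `((B u, v)) = a_h(u, v)` for all `u, v ∈ V_r`. -/
def IsReducedOperator (B : Module.End ℝ (T.Vr π j 𝔸)) : Prop :=
  ∀ u v : T.Vr π j 𝔸,
    T.discreteInner (B u : T.WeakFun π j) (v : T.WeakFun π j) = T.energyForm π j 𝔸 u v

open Classical in
/-- The reduced operator `A_r : V_r → V_r`. -/
def reducedOperator : Module.End ℝ (T.Vr π j 𝔸) :=
  if h : ∃ B, T.IsReducedOperator π j 𝔸 B then h.choose else 0

end Mesh

end WeakGalerkin

end

/-! ### Positive definite forms on finite-dimensional spaces -/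

namespace LinearMap

/-! Since `A_r` is self-adjoint for the discrete inner product `D`, its spectral radius is governed
by the Rayleigh quotient `a(v,v)/D(v,v)` on `V_r`. By ellipticity `a(v,v)` is comparable to `‖∇_w
v‖²`, so everything reduces to local scaling estimates.

Upper bound. `h² ‖∇_w v‖² ≤ C D(v,v)` for every weak function (`exists_gradNormSq_le`): the
definition of the weak gradient is tested with `∇_w v` itself, and the divergence and the trace of
the test field are absorbed by inverse estimates.

Lower bound. One test function is enough, namely `v = u - w`, where `u` is the indicator of an
interior edge/face `e` and `w = P_0 u`. Two facts show that `D(v,v) ≤ M h² a(v,v)`. (1) `D(u,u) ≤ C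
h² ‖∇_w v‖²` (`exists_discreteInner_indicator_le`). On an element with face `e`, testing `∇_w v`
with the constant field equal to the normal of `e` yields exactly the area of `e`: the field has
zero divergence, so the interior part of `v` drops out. (2) `D(w,w) ≤ C h² ‖∇_w w‖²` for weak
functions without boundary part (`exists_discreteInner_le`). Here the test field has divergence
`w_0` and norm at most `C h ‖w_0‖`. Since `w` is an energy projection, `a(w,w) ≤ a(u,u)`, and the
upper bound turns this into `D(w,w) ≤ C D(u,u)`. Fact (2) also makes `a` definite on `V_0`, which
gives `P_0`.

All constants are uniform because an element contains a ball of radius `r` and lies in the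
concentric ball of radius `2σr`. Pulling polynomials back to the unit ball leaves finite-dimensional
statements (`exists_sup_le_unitBall`); areas of faces are controlled by comparison with flat discs
(`exists_disc_subset`). -/

/-- A pairing with values in the dual is represented by a unique operator, if the form on the
target is definite. -/
theorem existsUnique_represent {E F : Type*} [AddCommGroup E] [Module ℝ E] [AddCommGroup F]
    [Module ℝ F] [FiniteDimensional ℝ F] (D : F →ₗ[ℝ] F →ₗ[ℝ] ℝ)
    (hD : ∀ u, D u u = 0 → u = 0) (L : E →ₗ[ℝ] F →ₗ[ℝ] ℝ) :
    ∃! P : E →ₗ[ℝ] F, ∀ u v, D (P u) v = L u v := by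
  have hinj : Function.Injective D := by
    rw [injective_iff_map_eq_zero]
    intro u hu
    exact hD u (by rw [hu]; rfl)
  let R : F ≃ₗ[ℝ] Module.Dual ℝ F := D.linearEquivOfInjective hinj Subspace.dual_finrank_eq.symm
  refine ⟨R.symm.toLinearMap ∘ₗ L, fun u v => ?_, fun P hP => ?_⟩
  · exact LinearMap.congr_fun (R.apply_symm_apply (L u)) v
  · ext u
    apply hinj
    ext v
    rw [hP u v]
    exact (LinearMap.congr_fun (R.apply_symm_apply (L u)) v).symm

/-- A linear functional on a finite-dimensional space is bounded with respect to each definite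
form. -/
theorem exists_sq_le_of_definite {W : Type*} [AddCommGroup W] [Module ℝ W]
    [FiniteDimensional ℝ W] (B : LinearMap.BilinForm ℝ W) (hs : ∀ x, 0 ≤ B x x) (hsymm : ∀ x y, B x y = B y x)
    (hB : ∀ x, B x x = 0 → x = 0) (l : W →ₗ[ℝ] ℝ) :
    ∃ C : ℝ, 0 ≤ C ∧ ∀ x, l x ^ 2 ≤ C * B x x := by
  -- `P 1` is the Riesz representative of `l`; the claim is Cauchy–Schwarz, with the squared norm of
  -- the representative as constant.
  obtain ⟨P, hP, -⟩ := existsUnique_represent B hB (LinearMap.toSpanSingleton ℝ _ l)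
  refine ⟨B (P 1) (P 1), hs _, fun x => ?_⟩
  have h := B.apply_mul_apply_le_of_forall_zero_le hs (P 1) x
  rwa [hsymm x, ← sq, hP, LinearMap.toSpanSingleton_apply, one_smul] at h

/-- Every eigenvalue of an operator represented by the pair of forms `D`, `a` is non-negative and
bounded by each upper bound of the Rayleigh quotient. -/
theorem spectralRadius_le_of_rayleigh {V : Type*} [AddCommGroup V] [Module ℝ V]
    [FiniteDimensional ℝ V] (D : LinearMap.BilinForm ℝ V) (hD : ∀ u, u ≠ 0 → 0 < D u u)
    (B : Module.End ℝ V) (hpos : ∀ u, 0 ≤ D (B u) u) {M : ℝ}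
    (hM : ∀ u, D (B u) u ≤ M * D u u) : spectralRadius ℝ B ≤ ENNReal.ofReal M := by
  refine iSup₂_le fun k hk => ?_
  obtain ⟨u, hu⟩ := (Module.End.hasEigenvalue_iff_mem_spectrum.2 hk).exists_hasEigenvector
  have hu0 := hD u hu.2
  have h1 := hpos u
  have h2 := hM u
  rw [hu.apply_eq_smul] at h1 h2
  simp only [map_smul, smul_apply, smul_eq_mul] at h1 h2
  have hk0 : 0 ≤ k := nonneg_of_mul_nonneg_left h1 hu0
  rw [← enorm_eq_nnnorm, ← ofReal_norm, Real.norm_of_nonneg hk0]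
  exact ENNReal.ofReal_le_ofReal (le_of_mul_le_mul_right h2 hu0)

/-- The spectral radius of an operator that is symmetric for the inner product `D` is at least each
value of its Rayleigh quotient. -/
theorem le_spectralRadius_of_rayleigh {V : Type*} [AddCommGroup V] [Module ℝ V]
    [FiniteDimensional ℝ V] (D : LinearMap.BilinForm ℝ V) (hDs : ∀ u v, D u v = D v u)
    (hD : ∀ u, u ≠ 0 → 0 < D u u) (B : Module.End ℝ V) (hB : ∀ u v, D (B u) v = D u (B v))
    {v : V} (hv : v ≠ 0) {m : ℝ} (hm : m * D v v ≤ D (B v) v) :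
    ENNReal.ofReal m ≤ spectralRadius ℝ B := by
  -- With `D` as inner product `B` is symmetric, so the spectral theorem provides an orthonormal
  -- eigenbasis.
  let core : InnerProductSpace.Core ℝ V :=
    { inner := fun u v => D u v
      conj_inner_symm := fun u v => by simpa using hDs v u
      re_inner_nonneg := fun u => by
        rcases eq_or_ne u 0 with rfl | h
        · simp
        · simpa using (hD u h).le
      add_left := fun u v w => by simp
      smul_left := fun u v r => by simp
      definite := fun u hu => by
        by_contra h
        exact (hD u h).ne' hu }
  let : NormedAddCommGroup V := core.toNormedAddCommGroup
  let : InnerProductSpace ℝ V := InnerProductSpace.ofCore core.toCore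
  have hinner : ∀ u v : V, inner ℝ u v = D u v := fun _ _ => rfl
  have hsym : B.IsSymmetric := fun u v => by rw [hinner, hinner, hB]
  set b := hsym.eigenvectorBasis rfl
  set ev := hsym.eigenvalues rfl
  have hDv : D v v = ∑ i, (b.repr v i) ^ 2 := by
    rw [← hinner, ← b.repr.inner_map_map, PiLp.inner_apply]
    exact Finset.sum_congr rfl fun i _ => by simp [sq]
  have hBv : D (B v) v = ∑ i, ev i * (b.repr v i) ^ 2 := by
    rw [← hinner, ← b.repr.inner_map_map, PiLp.inner_apply]
    refine Finset.sum_congr rfl fun i _ => ?_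
    rw [hsym.eigenvectorBasis_apply_self_apply rfl]
    simp [sq, ev, b]
    ring
  -- The Rayleigh quotient is a weighted mean of the eigenvalues, so one of them is at least `m`.
  obtain ⟨i, hi⟩ : ∃ i, m ≤ ev i := by
    by_contra! hlt
    have hne : ∃ i, b.repr v i ≠ 0 := by
      by_contra! h0
      exact (hD v hv).ne' (by rw [hDv]; simp [h0])
    obtain ⟨i, hi⟩ := hne
    have : ∑ i, ev i * (b.repr v i) ^ 2 < ∑ i, m * (b.repr v i) ^ 2 :=
      Finset.sum_lt_sum (fun i _ => mul_le_mul_of_nonneg_right (hlt i).le (sq_nonneg _))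
        ⟨i, Finset.mem_univ _, mul_lt_mul_of_pos_right (hlt i) (by positivity)⟩
    rw [← hBv, ← Finset.mul_sum, ← hDv] at this
    linarith
  have hev : Module.End.HasEigenvalue B (ev i) := hsym.hasEigenvalue_eigenvalues rfl i
  refine le_trans ?_ (le_iSup₂ (α := ENNReal) (ev i) hev.mem_spectrum)
  exact (ENNReal.ofReal_le_ofReal (hi.trans (le_abs_self _))).trans
    (by rw [← Real.norm_eq_abs, ofReal_norm]; rfl)

end LinearMap

namespace WeakGalerkin

/-! ### Polynomials on comparable sets -/

section Pullback

variable {d : ℕ}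

/-- Composition of a polynomial with the dilation `y ↦ x₀ + r y`. -/
noncomputable def dilate (x₀ : EuclideanSpace ℝ (Fin d)) (r : ℝ) :
    MvPolynomial (Fin d) ℝ →ₐ[ℝ] MvPolynomial (Fin d) ℝ :=
  MvPolynomial.aeval fun i => MvPolynomial.C (x₀ i) + MvPolynomial.C r * MvPolynomial.X i

lemma dilate_X (x₀ : EuclideanSpace ℝ (Fin d)) (r : ℝ) (i : Fin d) :
    dilate x₀ r (MvPolynomial.X i) =
      MvPolynomial.C (x₀ i) + MvPolynomial.C r * MvPolynomial.X i := by
  simp [dilate]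

lemma pval_dilate (x₀ : EuclideanSpace ℝ (Fin d)) (r : ℝ) (p : MvPolynomial (Fin d) ℝ)
    (y : EuclideanSpace ℝ (Fin d)) : pval (dilate x₀ r p) y = pval p (x₀ + r • y) := by
  induction p using MvPolynomial.induction_on with
  | C a => simp [pval, dilate]
  | add p q hp hq => simp only [map_add, pval_add, hp, hq]
  | mul_X p i hp =>
    have : ∀ a b : MvPolynomial (Fin d) ℝ, ∀ x, pval (a * b) x = pval a x * pval b x := by
      simp [pval]
    rw [map_mul, this, this, hp, dilate_X]
    simp [pval]

lemma totalDegree_dilate_le (x₀ : EuclideanSpace ℝ (Fin d)) (r : ℝ)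
    (p : MvPolynomial (Fin d) ℝ) : (dilate x₀ r p).totalDegree ≤ p.totalDegree := by
  have hlin : ∀ i, (dilate x₀ r (MvPolynomial.X i)).totalDegree ≤ 1 := fun i => by
    rw [dilate_X]
    refine (MvPolynomial.totalDegree_add _ _).trans (max_le (by simp) ?_)
    exact (MvPolynomial.totalDegree_mul _ _).trans (by simp)
  conv_lhs => rw [p.as_sum, map_sum]
  refine MvPolynomial.totalDegree_finsetSum_le fun s hs => ?_
  rw [MvPolynomial.monomial_eq, map_mul, ← MvPolynomial.algebraMap_eq, AlgHom.commutes,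
    MvPolynomial.algebraMap_eq]
  refine (MvPolynomial.totalDegree_mul _ _).trans ?_
  rw [MvPolynomial.totalDegree_C, zero_add, Finsupp.prod, map_prod]
  refine (MvPolynomial.totalDegree_finsetProd _ _).trans ?_
  refine le_trans (Finset.sum_le_sum (g := fun i => s i) fun i _ => ?_)
    (MvPolynomial.le_totalDegree hs)
  rw [map_pow]
  exact (MvPolynomial.totalDegree_pow _ _).trans
    ((Nat.mul_le_mul_left _ (hlin i)).trans (by simp))

lemma pderiv_dilate (x₀ : EuclideanSpace ℝ (Fin d)) (r : ℝ) (i : Fin d)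
    (p : MvPolynomial (Fin d) ℝ) :
    MvPolynomial.pderiv i (dilate x₀ r p) = r • dilate x₀ r (MvPolynomial.pderiv i p) := by
  induction p using MvPolynomial.induction_on with
  | C a => simp [dilate]
  | add p q hp hq => simp only [map_add, hp, hq, smul_add]
  | mul_X p k hp =>
    have hX : MvPolynomial.pderiv i (dilate x₀ r (MvPolynomial.X k)) =
        r • dilate x₀ r (MvPolynomial.pderiv i (MvPolynomial.X k)) := by
      rw [dilate_X]
      by_cases h : i = k
      · subst h
        simp [MvPolynomial.smul_eq_C_mul]
      · simp [MvPolynomial.pderiv_X_of_ne (Ne.symm h)]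
    rw [map_mul, Derivation.leibniz, Derivation.leibniz, hp, hX]
    simp only [smul_eq_mul, map_add, map_mul, smul_add, mul_smul_comm]

lemma dilate_dilate_inv (x₀ : EuclideanSpace ℝ (Fin d)) {r : ℝ} (hr : r ≠ 0)
    (p : MvPolynomial (Fin d) ℝ) : dilate (-(r⁻¹ • x₀)) r⁻¹ (dilate x₀ r p) = p := by
  refine MvPolynomial.funext fun x => ?_
  have h := pval_dilate (-(r⁻¹ • x₀)) r⁻¹ (dilate x₀ r p) (WithLp.toLp 2 x)
  rw [pval_dilate _ _ p, smul_add, smul_neg, smul_inv_smul₀ hr, smul_inv_smul₀ hr,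
    add_neg_cancel_left] at h
  simpa [pval] using h

/-- Change of variables; the Jacobian is the origin of the factor `(r ^ d)⁻¹` in the inverse
estimates below. -/
lemma setIntegral_comp_dilate (x₀ : EuclideanSpace ℝ (Fin d)) {r : ℝ} (hr : 0 < r)
    (f : EuclideanSpace ℝ (Fin d) → ℝ) :
    ∫ y in Metric.closedBall 0 1, f (x₀ + r • y) =
      (r ^ d)⁻¹ * ∫ x in Metric.closedBall x₀ r, f x := by
  rw [Measure.setIntegral_comp_smul_of_pos volume (fun y => f (x₀ + y)) _ hr,
    finrank_euclideanSpace_fin, smul_closedBall _ _ zero_le_one, smul_zero, smul_eq_mul,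
    Real.norm_of_nonneg hr.le, mul_one]
  congr 1
  have h := (measurePreserving_add_left volume x₀).setIntegral_preimage_emb
    (MeasurableEquiv.addLeft x₀).measurableEmbedding f (Metric.closedBall x₀ r)
  rw [← h, preimage_add_closedBall, sub_self]

end Pullback

/-! ### Scale-invariant inverse estimates for polynomials. -/

section Bounds

variable {d : ℕ}

lemma integrableOn_pval_sq (p : MvPolynomial (Fin d) ℝ) {S : Set (EuclideanSpace ℝ (Fin d))}
    (hS : IsCompact S) : IntegrableOn (fun x => pval p x ^ 2) S :=
  ((continuous_pval p).pow 2).continuousOn.integrableOn_compact hS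

/-- A linear family of polynomials is bounded on a ball in terms of the `L²` norm of the parameter
on the unit ball. -/
lemma exists_sup_le_unitBall (m : ℕ)
    (L : MvPolynomial.restrictTotalDegree (Fin d) ℝ m →ₗ[ℝ] MvPolynomial (Fin d) ℝ) (R : ℝ) :
    ∃ C : ℝ, 0 ≤ C ∧ ∀ (p : MvPolynomial.restrictTotalDegree (Fin d) ℝ m)
      (y : EuclideanSpace ℝ (Fin d)), ‖y‖ ≤ R →
        pval (L p) y ^ 2 ≤ C * ∫ x in Metric.closedBall 0 1, pval p.1 x ^ 2 := by
  let W := MvPolynomial.restrictTotalDegree (Fin d) ℝ m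
  have hcpt : IsCompact (Metric.closedBall (0 : EuclideanSpace ℝ (Fin d)) 1) :=
    isCompact_closedBall _ _
  have hint : ∀ p q : MvPolynomial (Fin d) ℝ,
      IntegrableOn (fun x => pval p x * pval q x) (Metric.closedBall 0 1) := fun p q =>
    ((continuous_pval p).mul (continuous_pval q)).continuousOn.integrableOn_compact hcpt
  let B : LinearMap.BilinForm ℝ W := LinearMap.mk₂ ℝ
    (fun p q => ∫ x in Metric.closedBall 0 1, pval p.1 x * pval q.1 x)
    (fun p p' q => by
      rw [← integral_add (hint _ _) (hint _ _)]
      simp [pval_add, add_mul])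
    (fun c p q => by
      rw [smul_eq_mul, ← integral_const_mul]
      simp [pval_smul, mul_assoc])
    (fun p q q' => by
      rw [← integral_add (hint _ _) (hint _ _)]
      simp [pval_add, mul_add])
    (fun c p q => by
      rw [smul_eq_mul, ← integral_const_mul]
      simp [pval_smul, mul_left_comm])
  have hBsq : ∀ p : W, B p p = ∫ x in Metric.closedBall 0 1, pval p.1 x ^ 2 := fun p => by
    simp [B, sq]
  have hnn : ∀ p : W, 0 ≤ B p p := fun p => by
    rw [hBsq]
    exact integral_nonneg fun x => sq_nonneg _
  have hsymm : ∀ p q, B p q = B q p := fun p q => by simp [B, mul_comm]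
  have hdef : ∀ p : W, B p p = 0 → p = 0 := by
    intro p hp
    rw [hBsq, integral_eq_zero_iff_of_nonneg (fun x => sq_nonneg _)
      (integrableOn_pval_sq _ hcpt)] at hp
    have h1 : (fun x => pval p.1 x ^ 2) =ᵐ[volume.restrict
        (Metric.ball (0 : EuclideanSpace ℝ (Fin d)) 1)] 0 :=
      ae_restrict_of_ae_restrict_of_subset Metric.ball_subset_closedBall hp
    have h2 := Measure.eqOn_open_of_ae_eq h1 Metric.isOpen_ball
      ((continuous_pval p.1).pow 2).continuousOn continuousOn_const
    -- The unit ball contains a box about the origin, a product of infinite sets, and a polynomial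
    -- vanishing on such a product is zero.
    let g : (Fin d → ℝ) → EuclideanSpace ℝ (Fin d) := WithLp.toLp 2
    have hg : Continuous g := PiLp.continuous_toLp 2 _
    obtain ⟨ε, hε, hb⟩ := Metric.isOpen_iff.1 (Metric.isOpen_ball.preimage hg) (0 : Fin d → ℝ)
      (show g 0 ∈ Metric.ball (0 : EuclideanSpace ℝ (Fin d)) 1 by simp [g])
    ext1
    refine MvPolynomial.funext_set (fun _ => Metric.ball (0 : ℝ) ε) (fun i => ?_) fun x hx => ?_
    · rw [Real.ball_eq_Ioo]
      exact Set.Ioo_infinite (by linarith)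
    · have hx' : x ∈ Metric.ball (0 : Fin d → ℝ) ε := by
        rw [ball_pi _ hε]; exact hx
      have h3 := h2 (hb hx')
      have h4 : pval p.1 (g x) = 0 := by simpa using h3
      simpa [pval, g] using h4
  -- Each coordinate functional is bounded by the `L²` norm (`c`) and the image of each basis vector
  -- is bounded on the ball of radius `R` (`M`); Cauchy–Schwarz over the basis combines the two.
  let b := Module.finBasis ℝ W
  choose c hc0 hc using fun i => LinearMap.exists_sq_le_of_definite B hnn hsymm hdef (b.coord i)
  have hbd : ∀ i, ∃ M : ℝ, ∀ y ∈ Metric.closedBall (0 : EuclideanSpace ℝ (Fin d)) R,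
      ‖pval (L (b i)) y‖ ≤ M := fun i =>
    (isCompact_closedBall _ _).exists_bound_of_continuousOn (continuous_pval _).continuousOn
  choose M hM using hbd
  refine ⟨(∑ i, c i) * ∑ i, M i ^ 2,
    mul_nonneg (Finset.sum_nonneg fun i _ => hc0 i) (Finset.sum_nonneg fun i _ => sq_nonneg _),
    fun p y hy => ?_⟩
  rw [← hBsq]
  have hexp : pval (L p) y = ∑ i, b.coord i p * pval (L (b i)) y := by
    have h := congrArg (fun q => MvPolynomial.eval (fun i => y i) (L q)) (b.sum_repr p).symm
    simpa only [pval, map_sum, map_smul, MvPolynomial.smul_eval, Module.Basis.coord_apply] using h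
  rw [hexp]
  refine (Finset.sum_mul_sq_le_sq_mul_sq _ _ _).trans ?_
  calc (∑ i, b.coord i p ^ 2) * ∑ i, pval (L (b i)) y ^ 2
      ≤ (∑ i, c i * B p p) * ∑ i, M i ^ 2 := by
        refine mul_le_mul (Finset.sum_le_sum fun i _ => hc i p) (Finset.sum_le_sum fun i _ => ?_)
          (Finset.sum_nonneg fun i _ => sq_nonneg _)
          (Finset.sum_nonneg fun i _ => mul_nonneg (hc0 i) (hnn p))
        rw [← sq_abs]
        exact pow_le_pow_left₀ (abs_nonneg _) (hM i y (by simpa using hy)) 2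
    _ = _ := by rw [← Finset.sum_mul]; ring

/-- A linear family of polynomials, applied to a polynomial transported from a set that is
comparable to a ball, is bounded by the `L²` norm on that set. -/
lemma exists_sup_dilate_le (m : ℕ)
    (L : MvPolynomial.restrictTotalDegree (Fin d) ℝ m →ₗ[ℝ] MvPolynomial (Fin d) ℝ) (R : ℝ) :
    ∃ C : ℝ, 0 ≤ C ∧ ∀ (x₀ : EuclideanSpace ℝ (Fin d)) (r : ℝ)
      (S : Set (EuclideanSpace ℝ (Fin d))), 0 < r → IsCompact S → Metric.closedBall x₀ r ⊆ S →
      S ⊆ Metric.closedBall x₀ (R * r) →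
      ∀ p q : MvPolynomial.restrictTotalDegree (Fin d) ℝ m, q.1 = dilate x₀ r p.1 → ∀ x ∈ S,
        pval (L q) (r⁻¹ • (x - x₀)) ^ 2 ≤ C * ((r ^ d)⁻¹ * ∫ x in S, pval p.1 x ^ 2) := by
  obtain ⟨C, hC, h⟩ := exists_sup_le_unitBall m L R
  refine ⟨C, hC, fun x₀ r S hr hS hB hSR p q hq x hx => ?_⟩
  -- The outer ball confines the rescaled point to norm at most `R`; the inner ball bounds the `L²`
  -- norm on the unit ball by that on `S`.
  refine (h q (r⁻¹ • (x - x₀)) ?_).trans (mul_le_mul_of_nonneg_left ?_ hC)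
  · rw [norm_smul, norm_inv, Real.norm_of_nonneg hr.le, inv_mul_le_iff₀ hr, mul_comm r]
    simpa [dist_eq_norm] using hSR hx
  · simp_rw [hq, pval_dilate]
    rw [setIntegral_comp_dilate x₀ hr fun x => pval p.1 x ^ 2]
    refine mul_le_mul_of_nonneg_left ?_ (by positivity)
    exact setIntegral_mono_set (integrableOn_pval_sq _ hS)
      (Filter.Eventually.of_forall fun x => sq_nonneg _) hB.eventuallyLE

lemma dilate_mem_restrictTotalDegree {m : ℕ} (x₀ : EuclideanSpace ℝ (Fin d)) (r : ℝ)
    {p : MvPolynomial (Fin d) ℝ} (hp : p ∈ MvPolynomial.restrictTotalDegree (Fin d) ℝ m) :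
    dilate x₀ r p ∈ MvPolynomial.restrictTotalDegree (Fin d) ℝ m := by
  rw [MvPolynomial.mem_restrictTotalDegree] at hp ⊢
  exact (totalDegree_dilate_le _ _ _).trans hp

/-- Inverse estimate: the maximum of a polynomial is bounded by its `L²` norm. -/
lemma exists_pval_sq_le (m : ℕ) (R : ℝ) :
    ∃ C : ℝ, 0 ≤ C ∧ ∀ (x₀ : EuclideanSpace ℝ (Fin d)) (r : ℝ)
      (S : Set (EuclideanSpace ℝ (Fin d))), 0 < r → IsCompact S → Metric.closedBall x₀ r ⊆ S →
      S ⊆ Metric.closedBall x₀ (R * r) →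
      ∀ p ∈ MvPolynomial.restrictTotalDegree (Fin d) ℝ m, ∀ x ∈ S,
        pval p x ^ 2 ≤ C * ((r ^ d)⁻¹ * ∫ x in S, pval p x ^ 2) := by
  obtain ⟨C, hC, h⟩ := exists_sup_dilate_le (d := d) m (Submodule.subtype _) R
  refine ⟨C, hC, fun x₀ r S hr hS hB hSR p hp x hx => ?_⟩
  have := h x₀ r S hr hS hB hSR ⟨p, hp⟩ ⟨_, dilate_mem_restrictTotalDegree x₀ r hp⟩ rfl x hx
  rwa [Submodule.subtype_apply, pval_dilate, smul_inv_smul₀ hr.ne', add_sub_cancel] at this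

/-- Inverse estimate for the derivatives of a polynomial. -/
lemma exists_pval_pderiv_sq_le (m : ℕ) (i : Fin d) (R : ℝ) :
    ∃ C : ℝ, 0 ≤ C ∧ ∀ (x₀ : EuclideanSpace ℝ (Fin d)) (r : ℝ)
      (S : Set (EuclideanSpace ℝ (Fin d))), 0 < r → IsCompact S → Metric.closedBall x₀ r ⊆ S →
      S ⊆ Metric.closedBall x₀ (R * r) →
      ∀ p ∈ MvPolynomial.restrictTotalDegree (Fin d) ℝ m, ∀ x ∈ S,
        r ^ 2 * pval (MvPolynomial.pderiv i p) x ^ 2 ≤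
          C * ((r ^ d)⁻¹ * ∫ x in S, pval p x ^ 2) := by
  obtain ⟨C, hC, h⟩ := exists_sup_dilate_le (d := d) m
    ((MvPolynomial.pderiv i).toLinearMap ∘ₗ Submodule.subtype _) R
  refine ⟨C, hC, fun x₀ r S hr hS hB hSR p hp x hx => ?_⟩
  have : pval (MvPolynomial.pderiv i (dilate x₀ r p)) (r⁻¹ • (x - x₀)) ^ 2 ≤ _ :=
    h x₀ r S hr hS hB hSR ⟨p, hp⟩ ⟨_, dilate_mem_restrictTotalDegree x₀ r hp⟩ rfl x hx
  rwa [pderiv_dilate, pval_smul, pval_dilate, smul_inv_smul₀ hr.ne',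
    add_sub_cancel, mul_pow] at this

end Bounds

/-! ### A right inverse of the divergence inside `G_j`. -/

section Divergence

variable {d : ℕ}

lemma divergence_apply (q : Fin d → MvPolynomial (Fin d) ℝ) :
    divergence q = ∑ i, MvPolynomial.pderiv i (q i) := by
  simp [divergence]

/-- The polynomial `∑ p_k / (d + k)`, where the `p_k` are the homogeneous components of `p`. -/
noncomputable def radialPrimitive (j : ℕ) :
    MvPolynomial (Fin d) ℝ →ₗ[ℝ] MvPolynomial (Fin d) ℝ :=
  ∑ k ∈ Finset.range (j + 1), ((d : ℝ) + k)⁻¹ • MvPolynomial.homogeneousComponent k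

lemma radialPrimitive_mem (j : ℕ) (p : MvPolynomial (Fin d) ℝ) :
    radialPrimitive j p ∈ MvPolynomial.restrictTotalDegree (Fin d) ℝ j := by
  simp only [radialPrimitive, LinearMap.sum_apply, LinearMap.smul_apply]
  refine Submodule.sum_mem _ fun k hk => Submodule.smul_mem _ _ ?_
  rw [MvPolynomial.mem_restrictTotalDegree]
  exact (MvPolynomial.homogeneousComponent_isHomogeneous k p).totalDegree_le.trans
    (Nat.lt_succ_iff.1 (Finset.mem_range.1 hk))

lemma sum_homogeneousComponent_of_totalDegree_le {j : ℕ} {p : MvPolynomial (Fin d) ℝ}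
    (hp : p.totalDegree ≤ j) :
    ∑ k ∈ Finset.range (j + 1), MvPolynomial.homogeneousComponent k p = p := by
  conv_rhs => rw [← MvPolynomial.sum_homogeneousComponent p]
  refine (Finset.sum_subset (Finset.range_mono (by omega)) fun k _ hk => ?_).symm
  exact MvPolynomial.homogeneousComponent_eq_zero _ _ (by simpa using hk)

/-- Euler's identity: for `u` homogeneous of degree `k` the field `x u` has divergence `(d + k) u`,
which the weights of `radialPrimitive` cancel degree by degree. -/
lemma divergence_radial (hd : 0 < d) {j : ℕ} {p : MvPolynomial (Fin d) ℝ}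
    (hp : p.totalDegree ≤ j) :
    divergence (fun i => MvPolynomial.X i * radialPrimitive j p) = p := by
  have hhom : ∀ (k : ℕ) (u : MvPolynomial (Fin d) ℝ), u.IsHomogeneous k →
      ∑ i, MvPolynomial.pderiv i (MvPolynomial.X i * u) = ((d : ℝ) + k) • u := by
    intro k u hu
    simp only [Derivation.leibniz, smul_eq_mul, MvPolynomial.pderiv_X_self, mul_one,
      Finset.sum_add_distrib]
    rw [hu.sum_X_mul_pderiv]
    simp only [Finset.sum_const, Finset.card_univ, Fintype.card_fin, add_smul,
      Nat.cast_smul_eq_nsmul]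
    exact add_comm _ _
  conv_rhs => rw [← sum_homogeneousComponent_of_totalDegree_le hp]
  rw [divergence_apply]
  simp only [radialPrimitive, LinearMap.sum_apply, LinearMap.smul_apply, Finset.mul_sum, map_sum]
  rw [Finset.sum_comm]
  refine Finset.sum_congr rfl fun k _ => ?_
  simp only [mul_smul_comm, Derivation.map_smul, ← Finset.smul_sum]
  rw [hhom k _ (MvPolynomial.homogeneousComponent_isHomogeneous k p), smul_smul,
    inv_mul_cancel₀ (by positivity), one_smul]

/-- For RT the components of degree below `j` stay in `[P_j]^d` after multiplication by `x`, and the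
top component is what the summand `P̂_j x` is made for. -/
lemma X_mul_mem_gradSpace (π : Pair) {j : ℕ} {p : MvPolynomial (Fin d) ℝ}
    (hp : p ∈ MvPolynomial.restrictTotalDegree (Fin d) ℝ j) :
    (fun i => MvPolynomial.X i * p) ∈ π.gradSpace d j := by
  rw [MvPolynomial.mem_restrictTotalDegree] at hp
  cases π
  · rw [← sum_homogeneousComponent_of_totalDegree_le hp]
    have : (fun i => MvPolynomial.X i * ∑ k ∈ Finset.range (j + 1),
        MvPolynomial.homogeneousComponent k p) = ∑ k ∈ Finset.range (j + 1),
          fun i : Fin d => MvPolynomial.X i * MvPolynomial.homogeneousComponent k p := by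
      ext1 i
      rw [Finset.mul_sum, Finset.sum_apply]
    rw [this, Finset.sum_range_succ]
    refine Submodule.add_mem_sup (Submodule.sum_mem _ fun k hk i _ => ?_)
      ⟨_, MvPolynomial.homogeneousComponent_isHomogeneous j p, ?_⟩
    · refine (MvPolynomial.mem_restrictTotalDegree _ _ _).2
        ((MvPolynomial.totalDegree_mul _ _).trans ?_)
      have h1 := (MvPolynomial.homogeneousComponent_isHomogeneous k p).totalDegree_le
      have h2 := Finset.mem_range.1 hk
      rw [MvPolynomial.totalDegree_X]
      omega
    · ext1 i
      simp [mul_comm]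
  · refine fun i _ => (MvPolynomial.mem_restrictTotalDegree _ _ _).2
      ((MvPolynomial.totalDegree_mul _ _).trans ?_)
    rw [MvPolynomial.totalDegree_X]
    omega

lemma mem_gradSpace_of_forall_mem (π : Pair) {j : ℕ} {q : Fin d → MvPolynomial (Fin d) ℝ}
    (hq : ∀ i, q i ∈ MvPolynomial.restrictTotalDegree (Fin d) ℝ j) : q ∈ π.gradSpace d j := by
  cases π
  · exact Submodule.mem_sup_left fun i _ => hq i
  · exact fun i _ => (MvPolynomial.mem_restrictTotalDegree _ _ _).2
      (((MvPolynomial.mem_restrictTotalDegree _ _ _).1 (hq i)).trans (Nat.le_succ j))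

/-- The degree `j + 1` serves both pairs, so the inverse estimates for fields need no case
distinction. -/
lemma apply_mem_of_mem_gradSpace (π : Pair) {j : ℕ} {q : Fin d → MvPolynomial (Fin d) ℝ}
    (hq : q ∈ π.gradSpace d j) (i : Fin d) :
    q i ∈ MvPolynomial.restrictTotalDegree (Fin d) ℝ (j + 1) := by
  cases π
  · obtain ⟨a, ha, b, ⟨u, hu, rfl⟩, rfl⟩ := Submodule.mem_sup.1 hq
    refine Submodule.add_mem _ ?_ ?_
    · have := ha i (Set.mem_univ i)
      rw [SetLike.mem_coe, MvPolynomial.mem_restrictTotalDegree] at this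
      rw [MvPolynomial.mem_restrictTotalDegree]
      exact this.trans (Nat.le_succ j)
    · rw [MvPolynomial.mem_restrictTotalDegree]
      have := ((MvPolynomial.mem_homogeneousSubmodule _ _).1 hu).totalDegree_le
      simp only [LinearMap.pi_apply, LinearMap.mulRight_apply]
      refine (MvPolynomial.totalDegree_mul _ _).trans ?_
      rw [MvPolynomial.totalDegree_X]
      omega
  · exact hq i (Set.mem_univ i)

/-- The divergence has a right inverse `P_j → G_j` that is bounded in a scaling invariant way. -/
lemma exists_divergence_eq (π : Pair) (hd : 0 < d) (j : ℕ) (R : ℝ) :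
    ∃ C : ℝ, 0 ≤ C ∧ ∀ (x₀ : EuclideanSpace ℝ (Fin d)) (r : ℝ)
      (S : Set (EuclideanSpace ℝ (Fin d))), 0 < r → IsCompact S → Metric.closedBall x₀ r ⊆ S →
      S ⊆ Metric.closedBall x₀ (R * r) →
      ∀ p ∈ MvPolynomial.restrictTotalDegree (Fin d) ℝ j, ∃ q ∈ π.gradSpace d j,
        divergence q = p ∧ ∀ i, ∀ x ∈ S,
          pval (q i) x ^ 2 ≤ C * r ^ 2 * ((r ^ d)⁻¹ * ∫ x in S, pval p x ^ 2) := by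
  choose C hC h using fun i : Fin d => exists_sup_dilate_le (d := d) j
    (LinearMap.mulLeft ℝ (MvPolynomial.X i) ∘ₗ radialPrimitive j ∘ₗ Submodule.subtype _) R
  refine ⟨∑ i, C i, Finset.sum_nonneg fun i _ => hC i, fun x₀ r S hr hS hB hSR p hp => ?_⟩
  have hp' := dilate_mem_restrictTotalDegree x₀ r hp
  set u := radialPrimitive j (dilate x₀ r p) with hu
  have hum : u ∈ MvPolynomial.restrictTotalDegree (Fin d) ℝ j := radialPrimitive_mem _ _
  have hvm := dilate_mem_restrictTotalDegree (-(r⁻¹ • x₀)) r⁻¹ hum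
  set v := dilate (-(r⁻¹ • x₀)) r⁻¹ u with hv
  -- Back in the original coordinates the field is `(x - x₀) v`. The part `-x₀ v` lies in `[P_j]^d`,
  -- and `x v` lies in `G_j` as well. The prefactor `r` cancels the `r⁻¹` of the chain rule and
  -- produces the `r ^ 2` of the bound.
  refine ⟨fun i => r • dilate (-(r⁻¹ • x₀)) r⁻¹ (MvPolynomial.X i * u), ?_, ?_, fun i x hx => ?_⟩
  · have : (fun i => r • dilate (-(r⁻¹ • x₀)) r⁻¹ (MvPolynomial.X i * u)) =
        (fun i : Fin d => (-x₀ i) • v) + fun i => MvPolynomial.X i * v := by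
      ext1 i
      rw [map_mul, dilate_X, ← hv, Pi.add_apply, add_mul, smul_add, MvPolynomial.C_mul',
        MvPolynomial.C_mul', smul_mul_assoc, smul_smul, smul_smul, mul_inv_cancel₀ hr.ne', one_smul]
      congr 2
      simp [mul_inv_cancel_left₀ hr.ne']
    rw [this]
    exact Submodule.add_mem _ (mem_gradSpace_of_forall_mem π fun i => Submodule.smul_mem _ _ hvm)
      (X_mul_mem_gradSpace π hvm)
  · rw [divergence_apply]
    simp only [Derivation.map_smul, pderiv_dilate, smul_smul, mul_inv_cancel₀ hr.ne', one_smul, ← map_sum]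
    have := divergence_radial hd ((MvPolynomial.mem_restrictTotalDegree _ _ _).1 hp')
    rw [divergence_apply, ← hu] at this
    rw [this, dilate_dilate_inv x₀ hr.ne']
  · have h1 := h i x₀ r S hr hS hB hSR ⟨p, hp⟩ ⟨_, hp'⟩ rfl x hx
    have h2 : r⁻¹ • (x - x₀) = -(r⁻¹ • x₀) + r⁻¹ • x := by rw [smul_sub]; abel
    rw [h2] at h1
    replace h1 : pval (MvPolynomial.X i * u) (-(r⁻¹ • x₀) + r⁻¹ • x) ^ 2 ≤ _ := h1
    have hI : 0 ≤ (r ^ d)⁻¹ * ∫ x in S, pval p x ^ 2 :=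
      mul_nonneg (by positivity) (integral_nonneg fun x => sq_nonneg _)
    rw [pval_smul, pval_dilate, mul_pow, mul_comm (∑ i, C i), mul_assoc]
    refine mul_le_mul_of_nonneg_left (h1.trans ?_) (sq_nonneg r)
    exact mul_le_mul_of_nonneg_right
      (Finset.single_le_sum (fun i _ => hC i) (Finset.mem_univ i)) hI

end Divergence

end WeakGalerkin

namespace WeakGalerkin

/-! ### Geometry of elements and faces -/

section Geometry

variable {d : ℕ}

/-- The volume of the unit ball of `ℝ^k`. -/
noncomputable def ballVolume (k : ℕ) : ℝ :=
  (volume (Metric.ball (0 : EuclideanSpace ℝ (Fin k)) 1)).toReal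

lemma ballVolume_pos (k : ℕ) : 0 < ballVolume k :=
  ENNReal.toReal_pos (Metric.measure_ball_pos _ _ one_pos).ne' measure_ball_lt_top.ne

lemma ofReal_ballVolume (k : ℕ) :
    ENNReal.ofReal (ballVolume k) = volume (Metric.ball (0 : EuclideanSpace ℝ (Fin k)) 1) :=
  ENNReal.ofReal_toReal measure_ball_lt_top.ne

/-- The disc with centre `z` and radius `ρ` in the affine subspace through `z` with direction
`V`. -/
def disc (V : Submodule ℝ (EuclideanSpace ℝ (Fin d))) (z : EuclideanSpace ℝ (Fin d)) (ρ : ℝ) :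
    Set (EuclideanSpace ℝ (Fin d)) :=
  {x | x - z ∈ V ∧ ‖x - z‖ ≤ ρ}

/-- An orthonormal basis of `V` presents the disc as an isometric image of a ball in `ℝ^k`, where
`μHE[k]` is Lebesgue measure. -/
lemma measure_disc {k : ℕ} (V : Submodule ℝ (EuclideanSpace ℝ (Fin d)))
    (hV : Module.finrank ℝ V = k) (z : EuclideanSpace ℝ (Fin d)) {ρ : ℝ} (hρ : 0 ≤ ρ) :
    μHE[k] (disc V z ρ) = ENNReal.ofReal (ρ ^ k * ballVolume k) := by
  subst hV
  let b := stdOrthonormalBasis ℝ V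
  let f : EuclideanSpace ℝ (Fin (Module.finrank ℝ V)) → EuclideanSpace ℝ (Fin d) :=
    fun y => z + (b.repr.symm y : V)
  have hf : Isometry f := by
    refine (isometry_add_left z).comp (isometry_subtype_coe.comp b.repr.symm.isometry)
  have himg : disc V z ρ = f '' Metric.closedBall 0 ρ := by
    ext x
    constructor
    · rintro ⟨h1, h2⟩
      refine ⟨b.repr ⟨x - z, h1⟩, ?_, ?_⟩
      · rw [mem_closedBall_zero_iff, LinearIsometryEquiv.norm_map]
        exact h2
      · simp [f]
    · rintro ⟨y, hy, rfl⟩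
      rw [mem_closedBall_zero_iff] at hy
      refine ⟨by simp [f], ?_⟩
      have : f y - z = (b.repr.symm y : V) := by simp [f]
      rw [this, ← Submodule.coe_norm, LinearIsometryEquiv.norm_map]
      exact hy
  rw [himg, hf.euclideanHausdorffMeasure_image, EuclideanSpace.euclideanHausdorffMeasure_eq_volume,
    Measure.addHaar_closedBall _ _ hρ, finrank_euclideanSpace_fin, ENNReal.ofReal_mul (by positivity),
    ofReal_ballVolume]

lemma measure_subtype_hull {k : ℕ} (s : Finset (EuclideanSpace ℝ (Fin d))) (U : Set (hull s)) :
    μHE[k] U = μHE[k] (Subtype.val '' U) :=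
  (isometry_subtype_coe.euclideanHausdorffMeasure_image U).symm

lemma sub_mem_vectorSpan_of_mem_hull {s : Finset (EuclideanSpace ℝ (Fin d))}
    {x y : EuclideanSpace ℝ (Fin d)} (hx : x ∈ hull s) (hy : y ∈ hull s) :
    x - y ∈ vectorSpan ℝ (s : Set (EuclideanSpace ℝ (Fin d))) := by
  rw [← direction_affineSpan]
  exact AffineSubspace.vsub_mem_direction (convexHull_subset_affineSpan _ hx)
    (convexHull_subset_affineSpan _ hy)

/-- If a cone contains a ball, then its base contains a disc of the same radius. -/
lemma exists_disc_subset {s : Finset (EuclideanSpace ℝ (Fin d))} (hs : s.Nonempty)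
    {p x₀ : EuclideanSpace ℝ (Fin d)} {r : ℝ} (hr : 0 < r)
    (hp : p ∉ affineSpan ℝ (s : Set (EuclideanSpace ℝ (Fin d))))
    (hB : Metric.closedBall x₀ r ⊆ convexHull ℝ (insert p (s : Set (EuclideanSpace ℝ (Fin d))))) :
    ∃ z ∈ hull s, disc (vectorSpan ℝ (s : Set (EuclideanSpace ℝ (Fin d)))) z r ⊆ hull s := by
  have hmem : ∀ x ∈ Metric.closedBall x₀ r, ∃ z ∈ hull s, ∃ a b : ℝ, 0 ≤ a ∧ 0 ≤ b ∧ a + b = 1 ∧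
      a • p + b • z = x := by
    intro x hx
    have := hB hx
    rw [convexHull_insert (by exact_mod_cast hs), mem_convexJoin] at this
    obtain ⟨p', hp', z, hz, a, b, ha, hb, hab, h⟩ := this
    rw [Set.mem_singleton_iff] at hp'
    subst hp'
    exact ⟨z, hz, a, b, ha, hb, hab, h⟩
  -- The centre of the disc is the point of the base lying on a ray from the apex through the centre
  -- of the ball.
  obtain ⟨z₀, hz₀, a₀, b₀, -, -, hab₀, h₀⟩ := hmem x₀ (Metric.mem_closedBall_self hr.le)
  have hpV : p - z₀ ∉ vectorSpan ℝ (s : Set (EuclideanSpace ℝ (Fin d))) := by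
    intro h
    apply hp
    have h1 := AffineSubspace.vadd_mem_of_mem_direction
      (by rwa [direction_affineSpan]) (convexHull_subset_affineSpan _ hz₀)
    simpa using h1
  refine ⟨z₀, hz₀, fun y hy => ?_⟩
  -- The centre of the ball is moved parallel to the base by `y - z₀`. The weight of the apex cannot
  -- change, so `y - z₀ = b (z - z₀)`, and `y` is a convex combination of two points of the base.
  obtain ⟨z, hz, a, b, ha, hb, hab, h⟩ := hmem (x₀ + (y - z₀)) (by simpa [dist_eq_norm] using hy.2)
  have hw : y - z₀ = (a - a₀) • (p - z₀) + b • (z - z₀) := by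
    have : y - z₀ = (a • p + b • z) - (a₀ • p + b₀ • z₀) := by rw [h, h₀]; abel
    rw [this, show b₀ = 1 - a₀ by linarith, show b = 1 - a by linarith]
    module
  have ha₀ : a - a₀ = 0 := by
    by_contra hne
    apply hpV
    have h2 : (a - a₀) • (p - z₀) ∈ vectorSpan ℝ (s : Set (EuclideanSpace ℝ (Fin d))) := by
      rw [show (a - a₀) • (p - z₀) = (y - z₀) - b • (z - z₀) by rw [hw]; abel]
      exact Submodule.sub_mem _ hy.1
        (Submodule.smul_mem _ _ (sub_mem_vectorSpan_of_mem_hull hz hz₀))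
    exact (Submodule.smul_mem_iff _ hne).1 h2
  rw [ha₀, zero_smul, zero_add] at hw
  have : y = (1 - b) • z₀ + b • z := by
    rw [← sub_add_cancel y z₀, hw]
    module
  rw [this]
  exact convex_convexHull ℝ _ hz₀ hz (by linarith) hb (by ring)

/-- Every relatively open subset of a hull that contains a disc has positive measure. -/
lemma isOpenPosMeasure_hull {k : ℕ} {s : Finset (EuclideanSpace ℝ (Fin d))}
    (hk : Module.finrank ℝ (vectorSpan ℝ (s : Set (EuclideanSpace ℝ (Fin d)))) = k)
    {z : EuclideanSpace ℝ (Fin d)} {ρ : ℝ} (hρ : 0 < ρ)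
    (hz : disc (vectorSpan ℝ (s : Set (EuclideanSpace ℝ (Fin d)))) z ρ ⊆ hull s) :
    (μHE[k] : Measure (hull s)).IsOpenPosMeasure := by
  set V := vectorSpan ℝ (s : Set (EuclideanSpace ℝ (Fin d))) with hV
  refine ⟨fun U hU ⟨y, hy⟩ => ?_⟩
  obtain ⟨ε, hε, hb⟩ := Metric.isOpen_iff.1 hU y hy
  have hzs : z ∈ hull s := hz ⟨by simp, by simpa using hρ.le⟩
  -- The disc is contracted towards `y` with ratio `t`: by convexity it stays in the hull, and for
  -- small `t` it lies in the ball of radius `ε` about `y`.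
  obtain ⟨t, ht0, ht1, ht⟩ : ∃ t : ℝ, 0 < t ∧ t ≤ 1 ∧ t * (‖z - y‖ + ρ) < ε := by
    refine ⟨min 1 (ε / (2 * (‖z - y‖ + ρ))), by positivity, min_le_left _ _, ?_⟩
    have hpos : 0 < ‖z - y‖ + ρ := by positivity
    calc _ ≤ ε / (2 * (‖z - y‖ + ρ)) * (‖z - y‖ + ρ) :=
          mul_le_mul_of_nonneg_right (min_le_right _ _) hpos.le
      _ = ε / 2 := by field_simp
      _ < ε := by linarith
  have hsub : disc V (y + t • (z - y)) (t * ρ) ⊆ Subtype.val '' U := by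
    rintro x ⟨h1, h2⟩
    set w := t⁻¹ • (x - (y + t • (z - y))) with hw
    have hwV : w ∈ V := Submodule.smul_mem _ _ h1
    have hwn : ‖w‖ ≤ ρ := by
      rw [hw, norm_smul, norm_inv, Real.norm_of_nonneg ht0.le, inv_mul_le_iff₀ ht0]
      exact h2
    have hx : x = (1 - t) • (y : EuclideanSpace ℝ (Fin d)) + t • (z + w) := by
      rw [hw, smul_add, smul_inv_smul₀ ht0.ne']
      module
    have hxs : x ∈ hull s := by
      rw [hx]
      refine convex_convexHull ℝ _ y.2 (hz ⟨?_, ?_⟩) (by linarith) ht0.le (by ring)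
      · simpa using hwV
      · simpa using hwn
    refine ⟨⟨x, hxs⟩, hb ?_, rfl⟩
    rw [Metric.mem_ball, Subtype.dist_eq, dist_eq_norm]
    have : x - y = t • ((z - y) + w) := by rw [hx]; module
    rw [this, norm_smul, Real.norm_of_nonneg ht0.le]
    exact (mul_le_mul_of_nonneg_left ((norm_add_le _ _).trans (by gcongr)) ht0.le).trans_lt ht
  rw [measure_subtype_hull]
  refine (lt_of_lt_of_le ?_ (measure_mono hsub)).ne'
  rw [measure_disc V hk _ (by positivity), ENNReal.ofReal_pos]
  have := ballVolume_pos k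
  positivity

lemma hull_subset_closedBall {s : Finset (EuclideanSpace ℝ (Fin d))}
    {x₀ : EuclideanSpace ℝ (Fin d)} (hx₀ : x₀ ∈ hull s) {R : ℝ} (hR : Metric.diam (hull s) ≤ R) :
    hull s ⊆ Metric.closedBall x₀ R := fun _ hx =>
  (Metric.dist_le_diam_of_mem (isCompact_hull s).isBounded hx hx₀).trans hR

lemma volume_hull_le {s : Finset (EuclideanSpace ℝ (Fin d))} {x₀ : EuclideanSpace ℝ (Fin d)}
    {R : ℝ} (hR : 0 ≤ R) (h : hull s ⊆ Metric.closedBall x₀ R) :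
    volume.real (hull s) ≤ R ^ d * ballVolume d := by
  refine ENNReal.toReal_le_of_le_ofReal
    (mul_nonneg (by positivity) (ballVolume_pos d).le) ((measure_mono h).trans ?_)
  rw [Measure.addHaar_closedBall _ _ hR, finrank_euclideanSpace_fin,
    ENNReal.ofReal_mul (by positivity), ofReal_ballVolume]

lemma card_smul_centroid {s : Finset (EuclideanSpace ℝ (Fin d))} (hs : s.Nonempty) :
    (s.card : ℝ) • s.centroid ℝ id = ∑ x ∈ s, x := by
  have hc : (s.card : ℝ) ≠ 0 := Nat.cast_ne_zero.2 (Finset.card_pos.2 hs).ne'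
  rw [Finset.centroid, Finset.affineCombination_eq_linear_combination _ _ _
    (Finset.sum_centroidWeights_eq_one_of_nonempty ℝ s hs)]
  simp only [Finset.centroidWeights_apply, Finset.smul_sum, smul_inv_smul₀ hc, id]

lemma centroid_mem_hull {s : Finset (EuclideanSpace ℝ (Fin d))} (hs : s.Nonempty) :
    s.centroid ℝ id ∈ hull s := by
  simpa using s.centroid_mem_convexHull hs (R := ℝ)

/-- Adding `p` shifts the centroid by a fixed multiple of the vector from the old centroid to `p`,
so `p` can be recovered from the shift. -/
lemma mem_affineSpan_of_centroid_sub_mem [DecidableEq (EuclideanSpace ℝ (Fin d))]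
    {s : Finset (EuclideanSpace ℝ (Fin d))}
    (hs : s.Nonempty) {p : EuclideanSpace ℝ (Fin d)} (hp : p ∉ s)
    (h : (insert p s).centroid ℝ id - s.centroid ℝ id ∈
      vectorSpan ℝ (s : Set (EuclideanSpace ℝ (Fin d)))) :
    p ∈ affineSpan ℝ (s : Set (EuclideanSpace ℝ (Fin d))) := by
  have h1 := card_smul_centroid hs
  have h2 := card_smul_centroid (Finset.insert_nonempty p s)
  rw [Finset.sum_insert hp, Finset.card_insert_of_notMem hp, ← h1] at h2
  have h3 : p = (s.card + 1 : ℝ) • ((insert p s).centroid ℝ id - s.centroid ℝ id) +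
      s.centroid ℝ id := by
    have h4 := eq_sub_of_add_eq h2.symm
    push_cast at h4
    refine h4.trans ?_
    module
  rw [h3]
  exact AffineSubspace.vadd_mem_of_mem_direction
    (by rw [direction_affineSpan]; exact Submodule.smul_mem _ _ h)
    (convexHull_subset_affineSpan _ (centroid_mem_hull hs))

end Geometry

/-! ### Faces, normals and incidences in a mesh. -/

section MeshGeometry

variable {d : ℕ} {Ω : Set (EuclideanSpace ℝ (Fin d))}

namespace Mesh

lemma mem_bdry (T : Mesh Ω) {K : T.Cell} {e : T.Face} : e ∈ T.bdry K ↔ e.1 ⊆ K.1 := by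
  simp [bdry]

/-- Counting all subsets of the vertex set is crude, but only a bound depending on `d` alone is
needed. -/
lemma card_bdry_le (T : Mesh Ω) (K : T.Cell) : (T.bdry K).card ≤ 2 ^ (d + 1) := by
  classical
  rw [← K.2.2, ← Finset.card_powerset]
  exact Finset.card_le_card_of_injOn Subtype.val
    (fun e he => by simpa using T.mem_bdry.1 he) Subtype.val_injective.injOn

lemma pos_dim (T : Mesh Ω) (e : T.Face) : 0 < d := by
  have h := Finset.card_pos.2 (T.nonempty_of_mem_faces e.2.1)
  rwa [e.2.2] at h

lemma finrank_vectorSpan_face (T : Mesh Ω) (e : T.Face) :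
    Module.finrank ℝ (vectorSpan ℝ (e.1 : Set (EuclideanSpace ℝ (Fin d)))) = d - 1 := by
  have hpos := T.pos_dim e
  have hcard := e.2.2
  have h1 := (T.indep e.2.1).finrank_vectorSpan (n := d - 1) (by simp; omega)
  rwa [Subtype.range_coe_subtype] at h1

lemma notMem_affineSpan_erase [DecidableEq (EuclideanSpace ℝ (Fin d))] (T : Mesh Ω)
    {s : Finset (EuclideanSpace ℝ (Fin d))} (hs : s ∈ T.faces) {p : EuclideanSpace ℝ (Fin d)}
    (hp : p ∈ s) :
    p ∉ affineSpan ℝ ((s.erase p : Finset _) : Set (EuclideanSpace ℝ (Fin d))) := by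
  intro h
  refine (T.indep hs).notMem_affineSpan_sdiff ⟨p, hp⟩ Set.univ
    (affineSpan_mono ℝ (fun x hx => ?_) h)
  have hx' := Finset.mem_erase.1 (Finset.mem_coe.1 hx)
  exact ⟨⟨x, hx'.2⟩, ⟨Set.mem_univ _, fun hxp =>
    hx'.1 (congrArg Subtype.val (Set.mem_singleton_iff.1 hxp))⟩, rfl⟩

/-- An element is a cone over each of its faces. -/
lemma exists_opposite_vertex (T : Mesh Ω) {K : T.Cell} {e : T.Face} (he : e ∈ T.bdry K) :
    ∃ p, p ∉ affineSpan ℝ (e.1 : Set (EuclideanSpace ℝ (Fin d))) ∧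
      p ∉ e.1 ∧ (K.1 : Set (EuclideanSpace ℝ (Fin d))) = insert p (e.1 : Set _) := by
  classical
  have hsub := T.mem_bdry.1 he
  have hc : (K.1 \ e.1).card = 1 := by
    rw [Finset.card_sdiff_of_subset hsub, K.2.2, e.2.2]; omega
  obtain ⟨p, hp⟩ := Finset.card_eq_one.1 hc
  have hp' : p ∈ K.1 ∧ p ∉ e.1 := Finset.mem_sdiff.1 (hp ▸ Finset.mem_singleton_self p)
  have hK : insert p e.1 = K.1 := by
    rw [Finset.insert_eq, ← hp, Finset.sdiff_union_of_subset hsub]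
  refine ⟨p, ?_, hp'.2, by rw [← hK]; simp⟩
  have h := T.notMem_affineSpan_erase K.2.1 hp'.1
  rwa [← hK, Finset.erase_insert hp'.2] at h

lemma hull_face_subset (T : Mesh Ω) {K : T.Cell} {e : T.Face} (he : e ∈ T.bdry K) :
    hull e.1 ⊆ hull K.1 :=
  convexHull_mono (by exact_mod_cast T.mem_bdry.1 he)

lemma exists_disc_subset_face (T : Mesh Ω) {K : T.Cell} {e : T.Face} (he : e ∈ T.bdry K)
    {x₀ : EuclideanSpace ℝ (Fin d)} {r : ℝ} (hr : 0 < r)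
    (hB : Metric.closedBall x₀ r ⊆ hull K.1) :
    ∃ z ∈ hull e.1,
      disc (vectorSpan ℝ (e.1 : Set (EuclideanSpace ℝ (Fin d)))) z r ⊆ hull e.1 := by
  obtain ⟨p, hp, -, hK⟩ := T.exists_opposite_vertex he
  rw [hull, hK] at hB
  exact exists_disc_subset (T.nonempty_of_mem_faces e.2.1) hr hp hB

/-- The area of an edge/face. -/
noncomputable def area (T : Mesh Ω) (e : T.Face) : ℝ :=
  (μHE[d - 1] : Measure (hull e.1)).real Set.univ

lemma le_area (T : Mesh Ω) {K : T.Cell} {e : T.Face} (he : e ∈ T.bdry K)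
    {x₀ : EuclideanSpace ℝ (Fin d)} {r : ℝ} (hr : 0 < r)
    (hB : Metric.closedBall x₀ r ⊆ hull K.1) : r ^ (d - 1) * ballVolume (d - 1) ≤ T.area e := by
  obtain ⟨z, -, hz⟩ := T.exists_disc_subset_face he hr hB
  rw [area, Measure.real, ← ENNReal.ofReal_le_iff_le_toReal (measure_ne_top _ _),
    ← measure_disc _ (T.finrank_vectorSpan_face e) z hr.le, measure_subtype_hull]
  exact measure_mono (by simpa using hz)

/-- The face lies in a disc about one of its own vertices; the distance from that vertex is at most
the diameter `2 * R` of the ball. -/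
lemma area_le (T : Mesh Ω) (e : T.Face) {x₀ : EuclideanSpace ℝ (Fin d)} {R : ℝ} (hR : 0 ≤ R)
    (h : hull e.1 ⊆ Metric.closedBall x₀ R) :
    T.area e ≤ (2 * R) ^ (d - 1) * ballVolume (d - 1) := by
  obtain ⟨z, hz⟩ := T.nonempty_of_mem_faces e.2.1
  have hz' : z ∈ hull e.1 := subset_convexHull ℝ _ hz
  refine ENNReal.toReal_le_of_le_ofReal
    (mul_nonneg (by positivity) (ballVolume_pos _).le) ?_
  rw [← measure_disc _ (T.finrank_vectorSpan_face e) z (by positivity), measure_subtype_hull]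
  refine measure_mono ?_
  rintro _ ⟨x, -, rfl⟩
  refine ⟨sub_mem_vectorSpan_of_mem_hull x.2 hz', ?_⟩
  rw [← dist_eq_norm]
  have h1 := Metric.mem_closedBall.1 (h x.2)
  have h2 := Metric.mem_closedBall.1 (h hz')
  have := dist_triangle_right (x : EuclideanSpace ℝ (Fin d)) z x₀
  linarith

lemma isOpenPosMeasure_face (T : Mesh Ω) {K : T.Cell} {e : T.Face} (he : e ∈ T.bdry K) :
    (μHE[d - 1] : Measure (hull e.1)).IsOpenPosMeasure := by
  obtain ⟨x, hx⟩ := interior_hull_nonempty T K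
  obtain ⟨r, hr, hB⟩ := Metric.nhds_basis_closedBall.mem_iff.1 (mem_interior_iff_mem_nhds.1 hx)
  obtain ⟨z, -, hz⟩ := T.exists_disc_subset_face he hr hB
  exact isOpenPosMeasure_hull (T.finrank_vectorSpan_face e) hr hz

/-- The normalization is by a non-zero vector: if the vector between the centroids were parallel to
`e`, the opposite vertex would lie in the affine span of `e`. -/
lemma norm_outerNormal (T : Mesh Ω) {K : T.Cell} {e : T.Face} (he : e ∈ T.bdry K) :
    ‖outerNormal K.1 e.1‖ = 1 := by
  classical
  obtain ⟨p, hp, hpe, hK⟩ := T.exists_opposite_vertex he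
  have hK' : K.1 = insert p e.1 := by exact_mod_cast hK
  have hd := T.pos_dim e
  have hne := T.nonempty_of_mem_faces e.2.1
  set V := vectorSpan ℝ (e.1 : Set (EuclideanSpace ℝ (Fin d))) with hV
  have hw : V.orthogonal.starProjection (e.1.centroid ℝ id - K.1.centroid ℝ id) ≠ 0 := by
    rw [Ne, Submodule.starProjection_apply_eq_zero_iff, Submodule.orthogonal_orthogonal]
    intro h
    refine hp (mem_affineSpan_of_centroid_sub_mem hne hpe ?_)
    rw [← hK', ← neg_sub]
    exact Submodule.neg_mem _ h
  simp only [outerNormal]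
  rw [norm_smul, norm_inv, norm_norm]
  exact inv_mul_cancel₀ (norm_ne_zero_iff.2 hw)

/-- The elements cover the closure of the domain. -/
lemma exists_cell_of_mem_closure (T : Mesh Ω) (hΩ : IsOpen Ω) {x : EuclideanSpace ℝ (Fin d)}
    (hx : x ∈ closure Ω) : ∃ K : T.Cell, x ∈ hull K.1 := by
  set U : Set (EuclideanSpace ℝ (Fin d)) := ⋃ K : T.Cell, hull K.1 with hU
  have hUc : IsClosed U := isClosed_iUnion_of_finite fun K => (isCompact_hull K.1).isClosed
  suffices h : Ω ⊆ U by
    obtain ⟨K, hK⟩ := Set.mem_iUnion.1 (closure_minimal h hUc hx)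
    exact ⟨K, hK⟩
  -- Otherwise the elements miss a non-empty open part of `Ω`. It is covered by finitely many
  -- simplices of lower dimension, hence null, which is absurd.
  by_contra hne
  have hopen : IsOpen (Ω \ U) := hΩ.sdiff hUc
  have hnon : (Ω \ U).Nonempty := Set.sdiff_nonempty.2 hne
  refine (hopen.measure_pos volume hnon).ne' ?_
  refine measure_mono_null (t := ⋃ s ∈ {s ∈ T.faces | s.card ≠ d + 1}, hull s) ?_ ?_
  · rintro y ⟨hyΩ, hyU⟩
    have hy : y ∈ T.space := by rw [T.space_eq]; exact subset_closure hyΩ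
    obtain ⟨s, hs, hys⟩ := T.mem_space_iff.1 hy
    refine Set.mem_iUnion₂.2 ⟨s, ⟨hs, fun hc => hyU ?_⟩, hys⟩
    exact Set.mem_iUnion.2 ⟨⟨s, hs, hc⟩, hys⟩
  · refine (measure_biUnion_null_iff (T.finite_faces.subset fun s hs => hs.1).countable).2 ?_
    rintro s ⟨hs, hc⟩
    refine measure_mono_null (convexHull_subset_affineSpan _)
      (Measure.addHaar_affineSubspace volume _ fun htop => hc ?_)
    have h := (T.indep hs).affineSpan_eq_top_iff_card_eq_finrank_add_one
    rw [Subtype.range_coe_subtype] at h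
    simpa using h.1 htop

/-- Every edge/face belongs to an element. -/
lemma exists_cell_of_face (T : Mesh Ω) (hΩ : IsOpen Ω) (e : T.Face) :
    ∃ K : T.Cell, e ∈ T.bdry K := by
  classical
  have hne := T.nonempty_of_mem_faces e.2.1
  have hc : e.1.centroid ℝ id ∈ hull e.1 := centroid_mem_hull hne
  have hcl : e.1.centroid ℝ id ∈ closure Ω := by
    rw [← T.space_eq]; exact T.convexHull_subset_space e.2.1 hc
  obtain ⟨K, hK⟩ := T.exists_cell_of_mem_closure hΩ hcl
  -- An element containing the centroid of `e` has `e` as a face: by conformity the centroid lies in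
  -- the hull of the common vertices, so a vertex `p` of `e` missing from `K` would be affinely
  -- dependent on the others.
  refine ⟨K, T.mem_bdry.2 fun p hp => ?_⟩
  by_contra hpK
  have h1 := T.inter_subset_convexHull e.2.1 K.2.1 ⟨hc, hK⟩
  have h2 : e.1.centroid ℝ id ∈ affineSpan ℝ
      ((e.1.erase p : Finset _) : Set (EuclideanSpace ℝ (Fin d))) := by
    refine affineSpan_mono ℝ (fun x hx => ?_) (convexHull_subset_affineSpan _ h1)
    have hxp : x ≠ p := fun h => hpK (h ▸ hx.2)
    simpa [hxp] using hx.1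
  have hf : (e.1.erase p).Nonempty := by
    by_contra hf
    rw [Finset.not_nonempty_iff_eq_empty] at hf
    rw [hf, Finset.coe_empty, AffineSubspace.span_empty] at h2
    exact AffineSubspace.notMem_bot _ _ _ h2
  refine T.notMem_affineSpan_erase e.2.1 hp
    (mem_affineSpan_of_centroid_sub_mem hf (Finset.notMem_erase p e.1) ?_)
  rw [Finset.insert_erase hp, ← direction_affineSpan]
  exact AffineSubspace.vsub_mem_direction h2
    (convexHull_subset_affineSpan _ (centroid_mem_hull hf))

/-- A mesh with an interior vertex has an interior edge/face. -/
lemma exists_interior_face (T : Mesh Ω) (hd : 2 ≤ d) (hΩ : IsOpen Ω) (hT : T.HasInteriorVertex) :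
    ∃ (K : T.Cell) (e : T.Face), e ∈ T.bdry K ∧ ¬ hull e.1 ⊆ frontier Ω := by
  classical
  obtain ⟨p, hp, hpf⟩ := hT
  have hp1 : {p} ∈ T.faces := T.mem_vertices.1 hp
  have hpcl : p ∈ closure Ω := by
    rw [← T.space_eq]; exact T.subset_space hp1 (by simp)
  obtain ⟨K, hK⟩ := T.exists_cell_of_mem_closure hΩ hpcl
  have hpK : p ∈ K.1 := by
    by_contra hpK
    have h1 := T.inter_subset_convexHull hp1 K.2.1 ⟨subset_convexHull ℝ _ (by simp), hK⟩
    have : ((({p} : Finset (EuclideanSpace ℝ (Fin d))) : Set (EuclideanSpace ℝ (Fin d))) ∩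
        (K.1 : Set (EuclideanSpace ℝ (Fin d)))) = ∅ := by
      ext x
      simp only [Finset.coe_singleton, Set.mem_inter_iff, Set.mem_singleton_iff, Finset.mem_coe,
        Set.mem_empty_iff_false, iff_false, not_and]
      rintro rfl
      exact hpK
    rw [this, convexHull_empty] at h1
    exact h1
  -- Deleting a vertex other than `p` leaves a face through `p`, which cannot lie in the frontier.
  obtain ⟨q, hq, hqp⟩ : ∃ q ∈ K.1, q ≠ p := by
    have : 1 < K.1.card := by rw [K.2.2]; omega
    exact Finset.exists_mem_ne this p
  have hpe : p ∈ K.1.erase q := Finset.mem_erase.2 ⟨hqp.symm, hpK⟩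
  refine ⟨K, ⟨K.1.erase q, T.down_closed K.2.1 (Finset.erase_subset _ _) ⟨p, hpe⟩, ?_⟩,
    T.mem_bdry.2 (Finset.erase_subset _ _), fun h => hpf (h (subset_convexHull ℝ _ hpe))⟩
  rw [Finset.card_erase_of_mem hq, K.2.2]
  rfl

end Mesh

end MeshGeometry

end WeakGalerkin

namespace WeakGalerkin

/-! ### Local estimates -/

/-- Young's inequality with a free weight `t`, later chosen so that one of the two terms can be
absorbed. -/
lemma abs_integral_mul_le {X : Type*} [MeasurableSpace X] {μ : Measure X} {f g : X → ℝ}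
    (hf : Integrable (fun x => f x ^ 2) μ) (hg : Integrable (fun x => g x ^ 2) μ) {t : ℝ}
    (ht : 0 < t) :
    |∫ x, f x * g x ∂μ| ≤ t * ∫ x, f x ^ 2 ∂μ + t⁻¹ * ∫ x, g x ^ 2 ∂μ := by
  rw [← integral_const_mul, ← integral_const_mul, ← integral_add (hf.const_mul t) (hg.const_mul t⁻¹)]
  refine abs_integral_le_integral_abs.trans (integral_mono_of_nonneg
    (Filter.Eventually.of_forall fun x => abs_nonneg _) ((hf.const_mul t).add (hg.const_mul t⁻¹))
    (Filter.Eventually.of_forall fun x => ?_))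
  have h1 : t * f x ^ 2 + t⁻¹ * g x ^ 2 = t⁻¹ * ((t * f x) ^ 2 + g x ^ 2) := by field_simp
  have h2 : |f x * g x| = t⁻¹ * (|t * f x| * |g x|) := by
    rw [abs_mul, abs_mul, abs_of_pos ht]; field_simp
  simp only [h1, h2]
  refine mul_le_mul_of_nonneg_left ?_ (by positivity)
  rw [← sq_abs (t * f x), ← sq_abs (g x)]
  nlinarith [sq_nonneg (|t * f x| - |g x|), abs_nonneg (t * f x), abs_nonneg (g x)]

lemma integral_sq_le_two_mul {X : Type*} [MeasurableSpace X] {μ : Measure X} {f g : X → ℝ}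
    (hf : Integrable (fun x => f x ^ 2) μ) (hg : Integrable (fun x => g x ^ 2) μ)
    (hfg : Integrable (fun x => (g x - f x) ^ 2) μ) :
    ∫ x, f x ^ 2 ∂μ ≤ 2 * ∫ x, (g x - f x) ^ 2 ∂μ + 2 * ∫ x, g x ^ 2 ∂μ := by
  rw [← integral_const_mul, ← integral_const_mul,
    ← integral_add (hfg.const_mul 2) (hg.const_mul 2)]
  refine integral_mono hf ((hfg.const_mul 2).add (hg.const_mul 2)) fun x => ?_
  change f x ^ 2 ≤ 2 * (g x - f x) ^ 2 + 2 * g x ^ 2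
  nlinarith [sq_nonneg (f x - 2 * g x)]

section Local

variable {d : ℕ} {Ω : Set (EuclideanSpace ℝ (Fin d))}

namespace Mesh

/-- The element `K` contains the ball of radius `r` about `x₀` and lies in the concentric ball of
radius `R r`. -/
structure Comparable (T : Mesh Ω) (R : ℝ) (K : T.Cell) (x₀ : EuclideanSpace ℝ (Fin d))
    (r : ℝ) : Prop where
  pos : 0 < r
  ball_subset : Metric.closedBall x₀ r ⊆ hull K.1
  subset_ball : hull K.1 ⊆ Metric.closedBall x₀ (R * r)

/-- Integrating a pointwise inverse estimate over the element costs its volume, which this balances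
against the factor `(r ^ d)⁻¹`. -/
lemma volume_cell_le (T : Mesh Ω) {R : ℝ} (hR : 0 ≤ R) {K : T.Cell}
    {x₀ : EuclideanSpace ℝ (Fin d)} {r : ℝ} (hK : T.Comparable R K x₀ r) :
    volume.real (hull K.1) * (r ^ d)⁻¹ ≤ R ^ d * ballVolume d := by
  have hr := hK.pos
  rw [mul_inv_le_iff₀ (by positivity)]
  refine (volume_hull_le (by positivity) hK.subset_ball).trans_eq ?_
  ring

/-- The analogue for faces; the area scales like `r ^ (d - 1)`, hence the extra `r`. -/
lemma area_face_le (T : Mesh Ω) {R : ℝ} (hR : 0 ≤ R) {K : T.Cell}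
    {x₀ : EuclideanSpace ℝ (Fin d)} {r : ℝ} (hK : T.Comparable R K x₀ r) {e : T.Face}
    (he : e ∈ T.bdry K) :
    r * T.area e * (r ^ d)⁻¹ ≤ (2 * R) ^ (d - 1) * ballVolume (d - 1) := by
  have hr := hK.pos
  rw [mul_inv_le_iff₀ (by positivity)]
  have h := T.area_le e (by positivity) ((T.hull_face_subset he).trans hK.subset_ball)
  have hd : r ^ d = r * r ^ (d - 1) := by
    rw [← pow_succ', Nat.sub_add_cancel (T.pos_dim e)]
  calc r * T.area e ≤ r * ((2 * (R * r)) ^ (d - 1) * ballVolume (d - 1)) :=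
        mul_le_mul_of_nonneg_left h hr.le
    _ = _ := by rw [hd, ← mul_assoc 2 R r, mul_pow (2 * R)]; ring

end Mesh

lemma setIntegral_hull_le (s : Finset (EuclideanSpace ℝ (Fin d)))
    {f : EuclideanSpace ℝ (Fin d) → ℝ} (hf : Continuous f) {M : ℝ} (h : ∀ x ∈ hull s, f x ≤ M) :
    ∫ x in hull s, f x ≤ volume.real (hull s) * M := by
  have hfin : volume (hull s) ≠ ⊤ := (isCompact_hull s).measure_lt_top.ne
  calc ∫ x in hull s, f x ≤ ∫ _ in hull s, M :=
        setIntegral_mono_on (integrableOn_hull s hf) (integrableOn_const hfin)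
          (isCompact_hull s).measurableSet h
    _ = _ := by simp

lemma integral_face_le (T : Mesh Ω) (e : T.Face) {f : hull e.1 → ℝ} (hf : Continuous f) {M : ℝ}
    (h : ∀ x, f x ≤ M) : ∫ x : hull e.1, f x ∂μHE[d - 1] ≤ T.area e * M := by
  calc ∫ x : hull e.1, f x ∂μHE[d - 1] ≤ ∫ _ : hull e.1, M ∂μHE[d - 1] :=
        integral_mono (integrable_face T e hf) (integrable_const M) h
    _ = _ := by simp [Mesh.area]

lemma fval_dotProduct_self (q : Fin d → MvPolynomial (Fin d) ℝ) (x : EuclideanSpace ℝ (Fin d)) :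
    fval q x ⬝ᵥ fval q x = ∑ i, pval (q i) x ^ 2 := by
  simp [dotProduct, fval, sq]

lemma integral_fval_dotProduct_self (s : Finset (EuclideanSpace ℝ (Fin d)))
    (q : Fin d → MvPolynomial (Fin d) ℝ) :
    ∫ x in hull s, fval q x ⬝ᵥ fval q x = ∑ i, ∫ x in hull s, pval (q i) x ^ 2 := by
  simp_rw [fval_dotProduct_self]
  exact integral_finsetSum _ fun i _ => integrableOn_pval_sq _ (isCompact_hull s)

lemma abs_integral_fval_dotProduct_le (s : Finset (EuclideanSpace ℝ (Fin d)))
    (p q : Fin d → MvPolynomial (Fin d) ℝ) {t : ℝ} (ht : 0 < t) :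
    |∫ x in hull s, fval p x ⬝ᵥ fval q x| ≤ t * (∫ x in hull s, fval p x ⬝ᵥ fval p x) +
      t⁻¹ * ∫ x in hull s, fval q x ⬝ᵥ fval q x := by
  have h : ∫ x in hull s, fval p x ⬝ᵥ fval q x =
      ∑ i, ∫ x in hull s, pval (p i) x * pval (q i) x :=
    integral_finsetSum _ fun i _ => integrable_mul_hull s _ _
  rw [h, integral_fval_dotProduct_self, integral_fval_dotProduct_self, Finset.mul_sum,
    Finset.mul_sum, ← Finset.sum_add_distrib]
  exact (Finset.abs_sum_le_sum_abs _ _).trans (Finset.sum_le_sum fun i _ =>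
    abs_integral_mul_le (integrableOn_pval_sq _ (isCompact_hull s))
      (integrableOn_pval_sq _ (isCompact_hull s)) ht)

/-- The trace inequality for polynomials. -/
lemma exists_trace_le (m : ℕ) {R : ℝ} (hR : 0 ≤ R) :
    ∃ C : ℝ, 0 < C ∧ ∀ (Ω : Set (EuclideanSpace ℝ (Fin d))) (T : Mesh Ω) (K : T.Cell)
      (x₀ : EuclideanSpace ℝ (Fin d)) (r : ℝ), T.Comparable R K x₀ r → ∀ e ∈ T.bdry K,
      ∀ p ∈ MvPolynomial.restrictTotalDegree (Fin d) ℝ m,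
        r * ∫ x : hull e.1, pval p x ^ 2 ∂μHE[d - 1] ≤ C * ∫ x in hull K.1, pval p x ^ 2 := by
  obtain ⟨C, hC, h⟩ := exists_pval_sq_le (d := d) m R
  have hκ := ballVolume_pos (d - 1)
  -- The summand `1` only makes the constant positive, so that later proofs may divide by it.
  refine ⟨C * ((2 * R) ^ (d - 1) * ballVolume (d - 1)) + 1, by positivity,
    fun Ω T K x₀ r hK e he p hp => ?_⟩
  have hr := hK.pos
  set I := ∫ x in hull K.1, pval p x ^ 2
  have hI : 0 ≤ I := integral_nonneg fun x => sq_nonneg _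
  have h1 := integral_face_le T e (f := fun x => pval p x ^ 2)
    (((continuous_pval p).comp continuous_subtype_val).pow 2) (M := C * ((r ^ d)⁻¹ * I)) fun x =>
      h x₀ r _ hr (isCompact_hull K.1) hK.ball_subset hK.subset_ball p hp x
        (T.hull_face_subset he x.2)
  calc r * ∫ x : hull e.1, pval p x ^ 2 ∂μHE[d - 1] ≤ r * (T.area e * (C * ((r ^ d)⁻¹ * I))) :=
        mul_le_mul_of_nonneg_left h1 hr.le
    _ = (C * I) * (r * T.area e * (r ^ d)⁻¹) := by ring
    _ ≤ (C * I) * ((2 * R) ^ (d - 1) * ballVolume (d - 1)) :=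
        mul_le_mul_of_nonneg_left (T.area_face_le hR hK he) (by positivity)
    _ ≤ _ := by rw [add_mul]; linarith

/-- As the normal is a unit vector, Cauchy–Schwarz bounds the flux by the field, and the trace
inequality applies to each component. -/
lemma exists_flux_le (π : Pair) (j : ℕ) {R : ℝ} (hR : 0 ≤ R) :
    ∃ C : ℝ, 0 < C ∧ ∀ (Ω : Set (EuclideanSpace ℝ (Fin d))) (T : Mesh Ω) (K : T.Cell)
      (x₀ : EuclideanSpace ℝ (Fin d)) (r : ℝ), T.Comparable R K x₀ r → ∀ e ∈ T.bdry K,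
      ∀ q ∈ π.gradSpace d j,
        r * ∫ x : hull e.1, (fval q x ⬝ᵥ outerNormal K.1 e.1) ^ 2 ∂μHE[d - 1] ≤
          C * ∫ x in hull K.1, fval q x ⬝ᵥ fval q x := by
  obtain ⟨C, hC, h⟩ := exists_trace_le (d := d) (j + 1) hR
  refine ⟨C, hC, fun Ω T K x₀ r hK e he q hq => ?_⟩
  have hr := hK.pos
  have hn : ∑ i, outerNormal K.1 e.1 i ^ 2 = 1 := by
    rw [← EuclideanSpace.real_norm_sq_eq, T.norm_outerNormal he, one_pow]
  have hint : ∀ i, Integrable (fun x : hull e.1 => pval (q i) x ^ 2) μHE[d - 1] := fun i =>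
    integrable_face T e (((continuous_pval _).comp continuous_subtype_val).pow 2)
  have h1 : ∫ x : hull e.1, (fval q x ⬝ᵥ outerNormal K.1 e.1) ^ 2 ∂μHE[d - 1] ≤
      ∫ x : hull e.1, ∑ i, pval (q i) x ^ 2 ∂μHE[d - 1] := by
    refine integral_mono (integrable_face T e
      ((((continuous_fval q).comp continuous_subtype_val).dotProduct continuous_const).pow 2))
      (integrable_finsetSum _ fun i _ => hint i) fun x => ?_
    refine (Finset.sum_mul_sq_le_sq_mul_sq _ _ _).trans_eq ?_
    rw [hn, mul_one]
    rfl
  rw [integral_finsetSum _ fun i _ => hint i] at h1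
  rw [integral_fval_dotProduct_self, Finset.mul_sum]
  refine (mul_le_mul_of_nonneg_left h1 hr.le).trans ?_
  rw [Finset.mul_sum]
  exact Finset.sum_le_sum fun i _ => h Ω T K x₀ r hK e he _ (apply_mem_of_mem_gradSpace π hq i)

/-- The pointwise derivative estimate is summed over the `d` components and integrated over the
element. -/
lemma exists_divergence_le (π : Pair) (j : ℕ) {R : ℝ} (hR : 0 ≤ R) :
    ∃ C : ℝ, 0 < C ∧ ∀ (Ω : Set (EuclideanSpace ℝ (Fin d))) (T : Mesh Ω) (K : T.Cell)
      (x₀ : EuclideanSpace ℝ (Fin d)) (r : ℝ), T.Comparable R K x₀ r → ∀ q ∈ π.gradSpace d j,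
        r ^ 2 * ∫ x in hull K.1, pval (divergence q) x ^ 2 ≤
          C * ∫ x in hull K.1, fval q x ⬝ᵥ fval q x := by
  choose C hC h using fun i : Fin d => exists_pval_pderiv_sq_le (d := d) (j + 1) i R
  have hκ := ballVolume_pos d
  have hS : 0 ≤ ∑ i, C i := Finset.sum_nonneg fun i _ => hC i
  refine ⟨d * (∑ i, C i) * (R ^ d * ballVolume d) + 1, by positivity,
    fun Ω T K x₀ r hK q hq => ?_⟩
  have hr := hK.pos
  set I := ∫ x in hull K.1, fval q x ⬝ᵥ fval q x with hI
  rw [integral_fval_dotProduct_self] at hI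
  have hnn : ∀ i, 0 ≤ ∫ x in hull K.1, pval (q i) x ^ 2 := fun i =>
    integral_nonneg fun x => sq_nonneg _
  have hI0 : 0 ≤ I := hI ▸ Finset.sum_nonneg fun i _ => hnn i
  have hpt : ∀ x ∈ hull K.1,
      r ^ 2 * pval (divergence q) x ^ 2 ≤ d * (∑ i, C i) * ((r ^ d)⁻¹ * I) := by
    intro x hx
    have h1 : pval (divergence q) x = ∑ i, pval (MvPolynomial.pderiv i (q i)) x := by
      simp [divergence_apply, pval]
    have h2 := sq_sum_le_card_mul_sum_sq (s := Finset.univ)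
      (f := fun i => pval (MvPolynomial.pderiv i (q i)) x)
    rw [Finset.card_univ, Fintype.card_fin] at h2
    rw [h1]
    calc r ^ 2 * (∑ i, pval (MvPolynomial.pderiv i (q i)) x) ^ 2
        ≤ r ^ 2 * (d * ∑ i, pval (MvPolynomial.pderiv i (q i)) x ^ 2) :=
          mul_le_mul_of_nonneg_left h2 (sq_nonneg r)
      _ = d * ∑ i, r ^ 2 * pval (MvPolynomial.pderiv i (q i)) x ^ 2 := by
          rw [← Finset.mul_sum]; ring
      _ ≤ d * ∑ i, C i * ((r ^ d)⁻¹ * I) := by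
          refine mul_le_mul_of_nonneg_left (Finset.sum_le_sum fun i _ => ?_) (Nat.cast_nonneg d)
          refine (h i x₀ r _ hr (isCompact_hull K.1) hK.ball_subset hK.subset_ball (q i)
            (apply_mem_of_mem_gradSpace π hq i) x hx).trans ?_
          refine mul_le_mul_of_nonneg_left (mul_le_mul_of_nonneg_left ?_ (by positivity)) (hC i)
          rw [hI]
          exact Finset.single_le_sum (f := fun i => ∫ x in hull K.1, pval (q i) x ^ 2)
            (fun i _ => hnn i) (Finset.mem_univ i)
      _ = _ := by rw [← Finset.sum_mul]; ring
  rw [← integral_const_mul]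
  refine (setIntegral_hull_le K.1 (continuous_const.mul ((continuous_pval _).pow 2)) hpt).trans ?_
  calc volume.real (hull K.1) * (d * (∑ i, C i) * ((r ^ d)⁻¹ * I))
      = (d * (∑ i, C i) * I) * (volume.real (hull K.1) * (r ^ d)⁻¹) := by ring
    _ ≤ (d * (∑ i, C i) * I) * (R ^ d * ballVolume d) :=
        mul_le_mul_of_nonneg_left (T.volume_cell_le hR hK) (by positivity)
    _ ≤ _ := by rw [add_mul]; linarith

/-- Provides the test field for the discrete Poincaré inequality, with the gain of a factor `r` in
norm. -/
lemma exists_divergence_inverse (π : Pair) (hd : 0 < d) (j : ℕ) {R : ℝ} (hR : 0 ≤ R) :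
    ∃ C : ℝ, 0 < C ∧ ∀ (Ω : Set (EuclideanSpace ℝ (Fin d))) (T : Mesh Ω) (K : T.Cell)
      (x₀ : EuclideanSpace ℝ (Fin d)) (r : ℝ), T.Comparable R K x₀ r →
      ∀ p ∈ MvPolynomial.restrictTotalDegree (Fin d) ℝ j, ∃ q ∈ π.gradSpace d j,
        divergence q = p ∧
        ∫ x in hull K.1, fval q x ⬝ᵥ fval q x ≤ C * (r ^ 2 * ∫ x in hull K.1, pval p x ^ 2) := by
  obtain ⟨C, hC, h⟩ := exists_divergence_eq (d := d) π hd j R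
  have hκ := ballVolume_pos d
  refine ⟨d * C * (R ^ d * ballVolume d) + 1, by positivity, fun Ω T K x₀ r hK p hp => ?_⟩
  have hr := hK.pos
  obtain ⟨q, hq, hdiv, hb⟩ := h x₀ r _ hr (isCompact_hull K.1) hK.ball_subset hK.subset_ball p hp
  refine ⟨q, hq, hdiv, ?_⟩
  set I := ∫ x in hull K.1, pval p x ^ 2
  have hI : 0 ≤ I := integral_nonneg fun x => sq_nonneg _
  rw [integral_fval_dotProduct_self]
  calc ∑ i, ∫ x in hull K.1, pval (q i) x ^ 2
      ≤ ∑ _i : Fin d, volume.real (hull K.1) * (C * r ^ 2 * ((r ^ d)⁻¹ * I)) :=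
        Finset.sum_le_sum fun i _ =>
          setIntegral_hull_le K.1 ((continuous_pval _).pow 2) fun x hx => hb i x hx
    _ = (d * C * (r ^ 2 * I)) * (volume.real (hull K.1) * (r ^ d)⁻¹) := by
        rw [Finset.sum_const, Finset.card_univ, Fintype.card_fin, nsmul_eq_mul]; ring
    _ ≤ (d * C * (r ^ 2 * I)) * (R ^ d * ballVolume d) :=
        mul_le_mul_of_nonneg_left (T.volume_cell_le hR hK) (by positivity)
    _ ≤ _ := by
        rw [add_mul]
        have : 0 ≤ r ^ 2 * I := by positivity
        linarith

namespace Mesh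

/-- `‖∇_w v‖²` on the element `K`. -/
noncomputable def gradSq (T : Mesh Ω) {π : Pair} {j : ℕ} (K : T.Cell) (v : T.WeakFun π j) : ℝ :=
  ∫ x in hull K.1, fval (weakGrad T π j K v).1 x ⬝ᵥ fval (weakGrad T π j K v).1 x

/-- `‖v_0‖²` on the element `K`. -/
noncomputable def cellSq (T : Mesh Ω) {π : Pair} {j : ℕ} (K : T.Cell) (v : T.WeakFun π j) : ℝ :=
  ∫ x in hull K.1, pval (cellPart K v) x ^ 2

/-- `‖v_0 - v_b‖²` on the edge/face `e` of the element `K`. -/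
noncomputable def jumpSq (T : Mesh Ω) {π : Pair} {j : ℕ} (K : T.Cell) (e : T.Face)
    (v : T.WeakFun π j) : ℝ :=
  ∫ x : hull e.1, (pval (cellPart K v) x - (facePart e v).1 x) ^ 2 ∂μHE[d - 1]

variable {T : Mesh Ω} {π : Pair} {j : ℕ}

lemma gradSq_nonneg (K : T.Cell) (v : T.WeakFun π j) : 0 ≤ T.gradSq K v :=
  integral_nonneg fun x => by
    rw [fval_dotProduct_self]; exact Finset.sum_nonneg fun i _ => sq_nonneg _

lemma cellSq_nonneg (K : T.Cell) (v : T.WeakFun π j) : 0 ≤ T.cellSq K v :=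
  integral_nonneg fun _ => sq_nonneg _

lemma jumpSq_nonneg (K : T.Cell) (e : T.Face) (v : T.WeakFun π j) : 0 ≤ T.jumpSq K e v :=
  integral_nonneg fun _ => sq_nonneg _

lemma cellPart_mem (K : T.Cell) (v : T.WeakFun π j) :
    cellPart K v ∈ MvPolynomial.restrictTotalDegree (Fin d) ℝ j :=
  (v.1 K).2

lemma continuous_facePart (e : T.Face) (v : T.WeakFun π j) :
    Continuous (facePart e v : hull e.1 → ℝ) :=
  continuous_of_mem_polyOn _

end Mesh

/-- The inverse estimate for the weak gradient. -/
lemma exists_gradSq_le (π : Pair) (j : ℕ) {R : ℝ} (hR : 0 ≤ R) :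
    ∃ C : ℝ, 0 < C ∧ ∀ (Ω : Set (EuclideanSpace ℝ (Fin d))) (T : Mesh Ω) (K : T.Cell)
      (x₀ : EuclideanSpace ℝ (Fin d)) (r : ℝ), T.Comparable R K x₀ r → ∀ v : T.WeakFun π j,
        r ^ 2 * T.gradSq K v ≤ C * (T.cellSq K v + r * ∑ e ∈ T.bdry K, T.jumpSq K e v) := by
  obtain ⟨C₁, hC₁, h₁⟩ := exists_divergence_le (d := d) π j hR
  obtain ⟨C₂, hC₂, h₂⟩ := exists_flux_le (d := d) π j hR
  obtain ⟨C₃, hC₃, h₃⟩ := exists_trace_le (d := d) j hR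
  set M : ℝ := 2 ^ (d + 1) with hM
  have hMpos : 0 < M := by positivity
  refine ⟨8 * C₁ + 16 * M ^ 2 * C₂ * C₃ + 16 * M * C₂, by positivity,
    fun Ω T K x₀ r hK v => ?_⟩
  have hr := hK.pos
  have hcard : ((T.bdry K).card : ℝ) ≤ M := by
    rw [hM]; exact_mod_cast T.card_bdry_le K
  have hG := T.gradSq_nonneg K v
  have hN := T.cellSq_nonneg K v
  -- The weak gradient is tested with itself. The Young weights `4 * C₁ / r ^ 2` and `4 * M * C₂ /
  -- r` are such that the divergence term and the at most `M` flux terms each contribute a quarter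
  -- of `gradSq`, which the left side absorbs.
  have hspec := weakGrad_spec T π j K v (weakGrad T π j K v)
  set g := weakGrad T π j K v with hg
  have hdiv := h₁ Ω T K x₀ r hK g.1 g.2
  have hcell := (abs_le.1 (abs_integral_mul_le (t := 4 * C₁ / r ^ 2)
    (integrableOn_pval_sq (Mesh.cellPart K v) (isCompact_hull K.1))
    (integrableOn_pval_sq (divergence g.1) (isCompact_hull K.1)) (by positivity))).1
  have hdiv' : (4 * C₁ / r ^ 2)⁻¹ * ∫ x in hull K.1, pval (divergence g.1) x ^ 2 ≤
      T.gradSq K v / 4 := by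
    rw [inv_div, div_mul_eq_mul_div, div_le_iff₀ (by positivity)]
    refine hdiv.trans_eq ?_
    rw [Mesh.gradSq, ← hg]; ring
  have hface : ∀ e ∈ T.bdry K, ∫ x : hull e.1, (Mesh.facePart e v).1 x *
      (fval g.1 x ⬝ᵥ outerNormal K.1 e.1) ∂μHE[d - 1] ≤
      4 * M * C₂ / r * (2 * T.jumpSq K e v) + 8 * M * C₂ * C₃ / r ^ 2 * T.cellSq K v +
        T.gradSq K v / (4 * M) := by
    intro e he
    have hcf := Mesh.continuous_facePart e v
    have hcp : Continuous fun x : hull e.1 => pval (Mesh.cellPart K v) x :=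
      (continuous_pval _).comp continuous_subtype_val
    have hy := (le_abs_self _).trans (abs_integral_mul_le (t := 4 * M * C₂ / r)
      (integrable_face T e (hcf.pow 2)) (integrable_face T e
      ((((continuous_fval g.1).comp continuous_subtype_val).dotProduct
        (continuous_const (y := (outerNormal K.1 e.1 : Fin d → ℝ)))).pow 2)) (by positivity))
    have hflux := h₂ Ω T K x₀ r hK e he g.1 g.2
    have hflux' : (4 * M * C₂ / r)⁻¹ *
        ∫ x : hull e.1, (fval g.1 x ⬝ᵥ outerNormal K.1 e.1) ^ 2 ∂μHE[d - 1] ≤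
        T.gradSq K v / (4 * M) := by
      rw [inv_div, div_mul_eq_mul_div, div_le_div_iff₀ (by positivity) (by positivity)]
      calc _ ≤ (C₂ * ∫ x in hull K.1, fval g.1 x ⬝ᵥ fval g.1 x) * (4 * M) :=
            mul_le_mul_of_nonneg_right hflux (by positivity)
        _ = _ := by rw [Mesh.gradSq, ← hg]; ring
    have htr := h₃ Ω T K x₀ r hK e he _ (Mesh.cellPart_mem K v)
    -- `v_b` is the trace of `v_0` minus the jump; the trace is controlled by `v_0` on the element.
    have hsplit : ∫ x : hull e.1, (Mesh.facePart e v).1 x ^ 2 ∂μHE[d - 1] ≤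
        2 * T.jumpSq K e v + 2 * (C₃ / r * T.cellSq K v) := by
      have h4 : ∫ x : hull e.1, pval (Mesh.cellPart K v) x ^ 2 ∂μHE[d - 1] ≤
          C₃ / r * T.cellSq K v := by
        rw [div_mul_eq_mul_div, le_div_iff₀ hr, mul_comm]
        exact htr
      refine le_trans ?_ (add_le_add_right (mul_le_mul_of_nonneg_left h4 zero_le_two) _)
      exact integral_sq_le_two_mul (integrable_face T e (hcf.pow 2))
        (integrable_face T e (hcp.pow 2)) (integrable_face T e ((hcp.sub hcf).pow 2))
    refine hy.trans (add_le_add ((mul_le_mul_of_nonneg_left hsplit (by positivity)).trans_eq ?_)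
      hflux')
    field_simp
    ring
  have hsum := Finset.sum_le_sum hface
  rw [Finset.sum_add_distrib, Finset.sum_add_distrib, ← Finset.mul_sum, ← Finset.mul_sum,
    Finset.sum_const, Finset.sum_const, nsmul_eq_mul, nsmul_eq_mul] at hsum
  set J := ∑ e ∈ T.bdry K, T.jumpSq K e v with hJ
  have hJ0 : 0 ≤ J := Finset.sum_nonneg fun e _ => T.jumpSq_nonneg K e v
  have hs1 : ((T.bdry K).card : ℝ) * (8 * M * C₂ * C₃ / r ^ 2 * T.cellSq K v) ≤
      M * (8 * M * C₂ * C₃ / r ^ 2 * T.cellSq K v) :=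
    mul_le_mul_of_nonneg_right hcard (by positivity)
  have hs2 : ((T.bdry K).card : ℝ) * (T.gradSq K v / (4 * M)) ≤ T.gradSq K v / 4 :=
    (mul_le_mul_of_nonneg_right hcard (by positivity)).trans_eq (by field_simp)
  have hmain : T.gradSq K v ≤ 4 * C₁ / r ^ 2 * T.cellSq K v + T.gradSq K v / 4 +
      (4 * M * C₂ / r * (2 * J) + M * (8 * M * C₂ * C₃ / r ^ 2 * T.cellSq K v) +
        T.gradSq K v / 4) := by
    have e1 : T.gradSq K v = _ := hspec
    have e2 : T.cellSq K v = ∫ x in hull K.1, pval (Mesh.cellPart K v) x ^ 2 := rfl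
    rw [← e2] at hcell
    linarith
  have hfin : T.gradSq K v ≤ 2 * (4 * C₁ / r ^ 2 * T.cellSq K v + 4 * M * C₂ / r * (2 * J) +
      M * (8 * M * C₂ * C₃ / r ^ 2 * T.cellSq K v)) := by linarith
  calc r ^ 2 * T.gradSq K v ≤ r ^ 2 * (2 * (4 * C₁ / r ^ 2 * T.cellSq K v +
        4 * M * C₂ / r * (2 * J) + M * (8 * M * C₂ * C₃ / r ^ 2 * T.cellSq K v))) :=
        mul_le_mul_of_nonneg_left hfin (sq_nonneg r)
    _ = (8 * C₁ + 16 * M ^ 2 * C₂ * C₃) * T.cellSq K v + 16 * M * C₂ * (r * J) := by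
        field_simp
        ring
    _ ≤ _ := by
        have a1 : 0 ≤ 16 * M * C₂ * T.cellSq K v := by positivity
        have a2 : 0 ≤ (8 * C₁ + 16 * M ^ 2 * C₂ * C₃) * (r * J) := by positivity
        linarith

/-- The discrete Poincaré inequality for weak functions without boundary part. -/
lemma exists_cellSq_le (π : Pair) (hd : 0 < d) (j : ℕ) {R : ℝ} (hR : 0 ≤ R) :
    ∃ C : ℝ, 0 < C ∧ ∀ (Ω : Set (EuclideanSpace ℝ (Fin d))) (T : Mesh Ω) (K : T.Cell)
      (x₀ : EuclideanSpace ℝ (Fin d)) (r : ℝ), T.Comparable R K x₀ r → ∀ v : T.WeakFun π j,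
        (∀ e ∈ T.bdry K, Mesh.facePart e v = 0) →
        T.cellSq K v ≤ C * (r ^ 2 * T.gradSq K v) := by
  obtain ⟨C, hC, h⟩ := exists_divergence_inverse (d := d) π hd j hR
  refine ⟨4 * C, by positivity, fun Ω T K x₀ r hK v hv => ?_⟩
  have hr := hK.pos
  -- Testing with a field of divergence `v_0` turns the right side into `-‖v_0‖²`, because the face
  -- terms vanish.
  obtain ⟨q, hq, hdiv, hb⟩ := h Ω T K x₀ r hK _ (Mesh.cellPart_mem K v)
  have hspec := weakGrad_spec T π j K v ⟨q, hq⟩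
  set g := weakGrad T π j K v with hg
  have hzero : ∑ e ∈ T.bdry K, ∫ x : hull e.1, (Mesh.facePart e v).1 x *
      (fval q x ⬝ᵥ outerNormal K.1 e.1) ∂μHE[d - 1] = 0 :=
    Finset.sum_eq_zero fun e he => by simp [hv e he]
  have hI : (∫ x in hull K.1, fval g.1 x ⬝ᵥ fval q x) = -T.cellSq K v := by
    refine hspec.trans ?_
    change -(∫ x in hull K.1, pval (Mesh.cellPart K v) x * pval (divergence q) x) + _ = _
    rw [hzero, add_zero, hdiv]
    simp [Mesh.cellSq, sq]
  have hy : |∫ x in hull K.1, fval g.1 x ⬝ᵥ fval q x| ≤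
      2 * C * r ^ 2 * T.gradSq K v +
        (2 * C * r ^ 2)⁻¹ * ∫ x in hull K.1, fval q x ⬝ᵥ fval q x :=
    abs_integral_fval_dotProduct_le K.1 g.1 q (by positivity)
  rw [hI, abs_neg, abs_of_nonneg (T.cellSq_nonneg K v)] at hy
  have hb' : (2 * C * r ^ 2)⁻¹ * ∫ x in hull K.1, fval q x ⬝ᵥ fval q x ≤ T.cellSq K v / 2 := by
    rw [inv_mul_le_iff₀ (by positivity)]
    refine hb.trans_eq ?_
    rw [Mesh.cellSq]; ring
  linarith

/-- The weak gradient of the indicator of a single edge/face is bounded from below. -/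
lemma exists_area_le (π : Pair) (j : ℕ) {R : ℝ} (hR : 0 ≤ R) :
    ∃ C : ℝ, 0 < C ∧ ∀ (Ω : Set (EuclideanSpace ℝ (Fin d))) (T : Mesh Ω) (K : T.Cell)
      (x₀ : EuclideanSpace ℝ (Fin d)) (r : ℝ), T.Comparable R K x₀ r → ∀ e ∈ T.bdry K,
      ∀ v : T.WeakFun π j, (∀ x, (Mesh.facePart e v).1 x = 1) →
        (∀ e' ∈ T.bdry K, e' ≠ e → Mesh.facePart e' v = 0) →
        T.area e ≤ C * (r * T.gradSq K v) := by
  have hκ := ballVolume_pos d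
  have hκ' := ballVolume_pos (d - 1)
  set C : ℝ := R ^ d * ballVolume d / ballVolume (d - 1) + 1 with hCdef
  have hC : 0 < C := by positivity
  refine ⟨4 * C, by positivity, fun Ω T K x₀ r hK e he v hv1 hv0 => ?_⟩
  have hr := hK.pos
  set n := outerNormal K.1 e.1 with hn
  -- The constant field `n` has zero divergence, so nothing about `v_0` matters, and its flux
  -- through `e` integrates to the area of `e`.
  let q : Fin d → MvPolynomial (Fin d) ℝ := fun i => MvPolynomial.C (n i)
  have hq : q ∈ π.gradSpace d j := mem_gradSpace_of_forall_mem π fun i => by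
    rw [MvPolynomial.mem_restrictTotalDegree, MvPolynomial.totalDegree_C]
    exact Nat.zero_le j
  have hval : ∀ x, fval q x = n := fun x => by ext i; simp [fval, pval, q]
  have hnn : (n : Fin d → ℝ) ⬝ᵥ n = 1 := by
    have : ∑ i, n i ^ 2 = 1 := by
      rw [← EuclideanSpace.real_norm_sq_eq, hn, T.norm_outerNormal he, one_pow]
    simpa [dotProduct, sq] using this
  have hdiv : divergence q = 0 := by simp [divergence_apply, q]
  have hspec := weakGrad_spec T π j K v ⟨q, hq⟩
  set g := weakGrad T π j K v with hg
  have hI : (∫ x in hull K.1, fval g.1 x ⬝ᵥ fval q x) = T.area e := by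
    refine hspec.trans ?_
    change -(∫ x in hull K.1, pval (Mesh.cellPart K v) x * pval (divergence q) x) +
      ∑ e ∈ T.bdry K, ∫ x : hull e.1, (Mesh.facePart e v).1 x *
        (fval q x ⬝ᵥ outerNormal K.1 e.1) ∂μHE[d - 1] = _
    rw [Finset.sum_eq_single_of_mem e he fun e' he' hne => by simp [hv0 e' he' hne]]
    simp [hdiv, hv1, hval, ← hn, hnn, Mesh.area, pval]
  have hqq : ∫ x in hull K.1, fval q x ⬝ᵥ fval q x = volume.real (hull K.1) := by
    simp [hval, hnn]
  -- The volume of `K` is at most `C * r` times the area of `e`, so with this weight half of the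
  -- area is absorbed.
  have hy := abs_integral_fval_dotProduct_le K.1 g.1 q (t := 2 * C * r) (by positivity)
  have ha := T.le_area he hr hK.ball_subset
  rw [hI, hqq] at hy
  have hvol : (2 * C * r)⁻¹ * volume.real (hull K.1) ≤ T.area e / 2 := by
    rw [inv_mul_le_iff₀ (by positivity)]
    have hd : r ^ d = r * r ^ (d - 1) := by
      rw [← pow_succ', Nat.sub_add_cancel (T.pos_dim e)]
    calc volume.real (hull K.1) ≤ (R * r) ^ d * ballVolume d :=
          volume_hull_le (by positivity) hK.subset_ball
      _ = r * (R ^ d * ballVolume d / ballVolume (d - 1)) *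
          (r ^ (d - 1) * ballVolume (d - 1)) := by
          rw [mul_pow, hd]; field_simp
      _ ≤ r * C * T.area e := by
          refine mul_le_mul (mul_le_mul_of_nonneg_left ?_ hr.le) ha (by positivity) (by positivity)
          rw [hCdef]; linarith
      _ = _ := by ring
  have hle := (le_abs_self _).trans hy
  have hgs : T.gradSq K v = ∫ x in hull K.1, fval g.1 x ⬝ᵥ fval g.1 x := rfl
  rw [← hgs] at hle
  linarith

end Local

end WeakGalerkin

namespace WeakGalerkin

/-! ### Global forms -/

section Global

variable {d : ℕ} {Ω : Set (EuclideanSpace ℝ (Fin d))}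

namespace Mesh

variable {T : Mesh Ω} {π : Pair} {j : ℕ}

lemma diam_le_size (T : Mesh Ω) (K : T.Cell) : Metric.diam (hull K.1) ≤ T.size :=
  le_ciSup (f := fun K : T.Cell => Metric.diam (hull K.1)) (Set.finite_range _).bddAbove K

/-- Shape regularity gives the two concentric balls; quasi-uniformity makes the local radius `r`
equivalent to the global `h`. -/
lemma exists_comparable (T : Mesh Ω) (hd : 0 < d) {σ τ : ℝ} (hτ : 0 < τ)
    (hσT : T.ShapeRegular σ) (hτT : T.QuasiUniform τ) (K : T.Cell) :
    ∃ (x₀ : EuclideanSpace ℝ (Fin d)) (r : ℝ), T.Comparable (2 * σ) K x₀ r ∧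
      T.size ≤ 2 * σ * τ * r ∧ r ≤ T.size := by
  obtain ⟨x₀, r, hr, hB, hdiam⟩ := hσT K
  have : Nonempty (Fin d) := ⟨⟨0, hd⟩⟩
  have hx₀ : x₀ ∈ hull K.1 := hB (Metric.mem_closedBall_self hr.le)
  refine ⟨x₀, r, ⟨hr, hB, hull_subset_closedBall hx₀ (hdiam.trans_eq (by ring))⟩, ?_, ?_⟩
  · exact (hτT K).trans ((mul_le_mul_of_nonneg_left hdiam hτ.le).trans_eq (by ring))
  · have h1 : 2 * r ≤ Metric.diam (hull K.1) := by
      rw [← Metric.diam_closedBall_eq x₀ hr.le]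
      exact Metric.diam_mono hB (isCompact_hull K.1).isBounded
    linarith [T.diam_le_size K]

instance : FiniteDimensional ℝ (T.WeakFun π j) := by
  have (e : T.Face) : FiniteDimensional ℝ (polyOn (π.faceDegree j) (hull e.1)) := by
    unfold polyOn; infer_instance
  exact inferInstanceAs (FiniteDimensional ℝ
    ((T.Cell → MvPolynomial.restrictTotalDegree (Fin d) ℝ j) ×
      (∀ e : T.Face, polyOn (π.faceDegree j) (hull e.1))))

lemma weakFun_eq_zero {v : T.WeakFun π j} (h0 : ∀ K, cellPart K v = 0)
    (hb : ∀ e, facePart e v = 0) : v = 0 :=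
  Prod.ext (funext fun K => Subtype.ext (h0 K)) (funext fun e => hb e)

lemma cellPart_eq_zero {K : T.Cell} {v : T.WeakFun π j} (h : T.cellSq K v = 0) :
    cellPart K v = 0 := by
  refine eq_zero_of_vanish T K _ fun x hx => ?_
  rw [cellSq, integral_eq_zero_iff_of_nonneg (fun x => sq_nonneg _)
    (integrableOn_pval_sq _ (isCompact_hull K.1))] at h
  have h1 : (fun x => pval (cellPart K v) x ^ 2) =ᵐ[volume.restrict (interior (hull K.1))] 0 :=
    ae_restrict_of_ae_restrict_of_subset interior_subset h
  have h2 := Measure.eqOn_open_of_ae_eq h1 isOpen_interior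
    ((continuous_pval _).pow 2).continuousOn continuousOn_const
  simpa using h2 hx

/-- With `v_0 = 0` the jump is `-v_b`. It vanishes almost everywhere, hence everywhere, since it is
continuous and surface measure charges open sets. -/
lemma facePart_eq_zero {K : T.Cell} {e : T.Face} (he : e ∈ T.bdry K) {v : T.WeakFun π j}
    (h0 : cellPart K v = 0) (h : T.jumpSq K e v = 0) : facePart e v = 0 := by
  have := T.isOpenPosMeasure_face he
  have hc : Continuous fun x : hull e.1 =>
      (pval (cellPart K v) x - (facePart e v).1 x) ^ 2 :=
    (((continuous_pval _).comp continuous_subtype_val).sub (continuous_facePart e v)).pow 2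
  rw [jumpSq, integral_eq_zero_iff_of_nonneg (fun x => sq_nonneg _) (integrable_face T e hc),
    hc.ae_eq_iff_eq μHE[d - 1] continuous_zero] at h
  ext1
  funext x
  have := congrFun h x
  simpa [h0, pval] using this

/-- `∑_K ‖∇_w v‖²_K`. -/
noncomputable def gradNormSq (T : Mesh Ω) {π : Pair} {j : ℕ} (v : T.WeakFun π j) : ℝ :=
  ∑ K : T.Cell, T.gradSq K v

lemma discreteInner_self (v : T.WeakFun π j) :
    T.discreteInner v v =
      ∑ K : T.Cell, (T.cellSq K v + T.size * ∑ e ∈ T.bdry K, T.jumpSq K e v) := by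
  simp only [discreteInner, cellSq, jumpSq, sq]

/-- The discrete inner product is a bilinear form. -/
lemma exists_discreteInner_eq (T : Mesh Ω) (π : Pair) (j : ℕ) :
    ∃ D : LinearMap.BilinForm ℝ (T.WeakFun π j), (∀ u v, T.discreteInner u v = D u v) ∧
      ∀ u v, D u v = D v u := by
  have hsymm : ∀ u v : T.WeakFun π j, T.discreteInner u v = T.discreteInner v u := fun u v => by
    simp only [discreteInner, mul_comm]
  have hf : ∀ (e : T.Face) (K : T.Cell) (u v : T.WeakFun π j), Integrable (fun x : hull e.1 =>
      (pval (cellPart K u) x - (facePart e u).1 x) *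
        (pval (cellPart K v) x - (facePart e v).1 x)) μHE[d - 1] := fun e K u v =>
    integrable_face T e
      ((((continuous_pval _).comp continuous_subtype_val).sub (continuous_facePart e u)).mul
        (((continuous_pval _).comp continuous_subtype_val).sub (continuous_facePart e v)))
  have hadd : ∀ u u' v : T.WeakFun π j,
      T.discreteInner (u + u') v = T.discreteInner u v + T.discreteInner u' v := by
    intro u u' v
    rw [discreteInner, discreteInner, discreteInner, ← Finset.sum_add_distrib]
    refine Finset.sum_congr rfl fun K _ => ?_
    have h1 : ∫ x in hull K.1, pval (cellPart K (u + u')) x * pval (cellPart K v) x =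
        (∫ x in hull K.1, pval (cellPart K u) x * pval (cellPart K v) x) +
          ∫ x in hull K.1, pval (cellPart K u') x * pval (cellPart K v) x := by
      rw [← integral_add (integrable_mul_hull _ _ _) (integrable_mul_hull _ _ _)]
      simp only [map_add, pval_add, add_mul]
    have h2 : ∀ e ∈ T.bdry K, ∫ x : hull e.1,
        (pval (cellPart K (u + u')) x - (facePart e (u + u')).1 x) *
          (pval (cellPart K v) x - (facePart e v).1 x) ∂μHE[d - 1] =
        (∫ x : hull e.1, (pval (cellPart K u) x - (facePart e u).1 x) *
          (pval (cellPart K v) x - (facePart e v).1 x) ∂μHE[d - 1]) +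
        ∫ x : hull e.1, (pval (cellPart K u') x - (facePart e u').1 x) *
          (pval (cellPart K v) x - (facePart e v).1 x) ∂μHE[d - 1] := by
      intro e _
      rw [← integral_add (hf e K u v) (hf e K u' v)]
      simp only [map_add, pval_add, Submodule.coe_add, Pi.add_apply]
      exact integral_congr_ae (Filter.Eventually.of_forall fun x => by ring)
    rw [h1, Finset.sum_congr rfl h2, Finset.sum_add_distrib]
    ring
  have hsmul : ∀ (c : ℝ) (u v : T.WeakFun π j),
      T.discreteInner (c • u) v = c • T.discreteInner u v := by
    intro c u v
    rw [discreteInner, discreteInner, smul_eq_mul, Finset.mul_sum]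
    refine Finset.sum_congr rfl fun K _ => ?_
    simp only [map_smul, pval_smul, Submodule.coe_smul, Pi.smul_apply, smul_eq_mul, ← mul_sub,
      mul_assoc, integral_const_mul, ← Finset.mul_sum]
    ring
  refine ⟨LinearMap.mk₂ ℝ (fun u v => T.discreteInner u v) hadd hsmul (fun u v v' => ?_)
    (fun c u v => ?_), fun u v => rfl, hsymm⟩
  · rw [hsymm, hadd, hsymm v, hsymm v']
  · rw [hsymm, hsmul, hsymm v]

/-- The discrete inner product is positive definite. -/
lemma discreteInner_pos (T : Mesh Ω) (hΩ : IsOpen Ω) (hT : 0 < T.size) {v : T.WeakFun π j}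
    (hv : v ≠ 0) : 0 < T.discreteInner v v := by
  have hJ : ∀ K : T.Cell, 0 ≤ ∑ e ∈ T.bdry K, T.jumpSq K e v := fun K =>
    Finset.sum_nonneg fun e _ => T.jumpSq_nonneg K e v
  have hnn : ∀ K ∈ Finset.univ, 0 ≤ T.cellSq K v + T.size * ∑ e ∈ T.bdry K, T.jumpSq K e v :=
    fun K _ => add_nonneg (T.cellSq_nonneg K v) (mul_nonneg hT.le (hJ K))
  rw [discreteInner_self]
  refine lt_of_le_of_ne (Finset.sum_nonneg hnn) fun h => hv ?_
  have h1 := (Finset.sum_eq_zero_iff_of_nonneg hnn).1 h.symm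
  have h2 : ∀ K : T.Cell, T.cellSq K v = 0 ∧ ∑ e ∈ T.bdry K, T.jumpSq K e v = 0 := fun K => by
    obtain ⟨a, b⟩ := (add_eq_zero_iff_of_nonneg (T.cellSq_nonneg K v)
      (mul_nonneg hT.le (hJ K))).1 (h1 K (Finset.mem_univ K))
    exact ⟨a, (mul_eq_zero.1 b).resolve_left hT.ne'⟩
  have h3 : ∀ K : T.Cell, cellPart K v = 0 := fun K => cellPart_eq_zero (h2 K).1
  refine weakFun_eq_zero h3 fun e => ?_
  -- The form sees `v_b` only through elements, so every face must belong to one.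
  obtain ⟨K, he⟩ := T.exists_cell_of_face hΩ e
  exact facePart_eq_zero he (h3 K)
    ((Finset.sum_eq_zero_iff_of_nonneg fun e _ => T.jumpSq_nonneg K e v).1 (h2 K).2 e he)

/-- On each element, a piecewise constant diffusion matrix agrees almost everywhere with a constant
diffusion matrix. -/
lemma exists_cell_diffusion (T : Mesh Ω) {α β : ℝ}
    {𝔸 : EuclideanSpace ℝ (Fin d) → Matrix (Fin d) (Fin d) ℝ} (hA : IsDiffusion Ω α β 𝔸)
    (hc : T.IsPiecewiseConstant 𝔸) (K : T.Cell) :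
    ∃ B : Matrix (Fin d) (Fin d) ℝ, (∀ᵐ x ∂volume.restrict (hull K.1), 𝔸 x = B) ∧ B.IsSymm ∧
      ∀ ξ : Fin d → ℝ, α * (ξ ⬝ᵥ ξ) ≤ ξ ⬝ᵥ B.mulVec ξ ∧ ξ ⬝ᵥ B.mulVec ξ ≤ β * (ξ ⬝ᵥ ξ) := by
  obtain ⟨B, hB⟩ := hc K
  obtain ⟨y, hy⟩ := interior_hull_nonempty T K
  have hycl : y ∈ closure Ω := by
    rw [← T.space_eq]
    exact T.convexHull_subset_space K.2.1 (interior_subset hy)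
  -- The bounds on `𝔸` are assumed only in `Ω`, so the constant value is read off at an interior
  -- point of `K` that lies in `Ω`.
  obtain ⟨x, hxK, hxΩ⟩ := mem_closure_iff.1 hycl _ isOpen_interior hy
  refine ⟨B, ?_, ?_⟩
  · have hfr : volume (frontier (hull K.1)) = 0 := (convex_convexHull ℝ _).addHaar_frontier volume
    rw [ae_restrict_iff' (isCompact_hull K.1).measurableSet]
    filter_upwards [measure_eq_zero_iff_ae_notMem.1 hfr] with z hz hzK
    refine hB z ?_
    by_contra hzi
    exact hz ⟨subset_closure hzK, hzi⟩
  · rw [← hB x hxK]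
    exact hA x hxΩ

/-- For a piecewise constant diffusion matrix, `a_h` is a symmetric bilinear form that is equivalent
to the norm of the weak gradient. -/
lemma exists_energyForm_eq (T : Mesh Ω) (π : Pair) (j : ℕ) {α β : ℝ}
    {𝔸 : EuclideanSpace ℝ (Fin d) → Matrix (Fin d) (Fin d) ℝ} (hA : IsDiffusion Ω α β 𝔸)
    (hc : T.IsPiecewiseConstant 𝔸) :
    ∃ a : LinearMap.BilinForm ℝ (T.WeakFun π j), (∀ u v, T.energyForm π j 𝔸 u v = a u v) ∧
      (∀ u v, a u v = a v u) ∧ (∀ v, α * T.gradNormSq v ≤ a v v) ∧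
      ∀ v, a v v ≤ β * T.gradNormSq v := by
  choose B hB hBs hBb using T.exists_cell_diffusion hA hc
  have hcont : ∀ (K : T.Cell) (p q : Fin d → MvPolynomial (Fin d) ℝ),
      Continuous fun x => (B K).mulVec (fval p x) ⬝ᵥ fval q x := fun K p q =>
    (continuous_const.matrix_mulVec (continuous_fval p)).dotProduct (continuous_fval q)
  -- With `𝔸` replaced by constants off a null set the integrands are continuous, and integrability
  -- is automatic.
  have heq : ∀ u v : T.WeakFun π j, T.energyForm π j 𝔸 u v = ∑ K : T.Cell, ∫ x in hull K.1,
      (B K).mulVec (fval (weakGrad T π j K u).1 x) ⬝ᵥ fval (weakGrad T π j K v).1 x := by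
    intro u v
    refine Finset.sum_congr rfl fun K _ => integral_congr_ae ?_
    filter_upwards [hB K] with x hx
    rw [hx]
  have hsymm : ∀ u v : T.WeakFun π j, T.energyForm π j 𝔸 u v = T.energyForm π j 𝔸 v u := by
    intro u v
    rw [heq, heq]
    refine Finset.sum_congr rfl fun K _ => integral_congr_ae
      (Filter.Eventually.of_forall fun x => ?_)
    change _ = _ ⬝ᵥ _
    rw [dotProduct_comm, Matrix.dotProduct_mulVec, ← Matrix.mulVec_transpose, (hBs K).eq]
  have hadd : ∀ u u' v : T.WeakFun π j, T.energyForm π j 𝔸 (u + u') v =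
      T.energyForm π j 𝔸 u v + T.energyForm π j 𝔸 u' v := by
    intro u u' v
    rw [heq, heq, heq, ← Finset.sum_add_distrib]
    refine Finset.sum_congr rfl fun K _ => ?_
    rw [← integral_add (integrableOn_hull _ (hcont K _ _)) (integrableOn_hull _ (hcont K _ _))]
    simp only [map_add, Submodule.coe_add, fval_add, Matrix.mulVec_add, add_dotProduct]
  have hsmul : ∀ (c : ℝ) (u v : T.WeakFun π j), T.energyForm π j 𝔸 (c • u) v =
      c • T.energyForm π j 𝔸 u v := by
    intro c u v
    rw [heq, heq, smul_eq_mul, Finset.mul_sum]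
    refine Finset.sum_congr rfl fun K _ => ?_
    rw [← integral_const_mul]
    simp only [map_smul, Submodule.coe_smul, fval_smul, Matrix.mulVec_smul, smul_dotProduct,
      smul_eq_mul]
  have hgrad : ∀ (K : T.Cell) (v : T.WeakFun π j), Continuous fun x =>
      fval (weakGrad T π j K v).1 x ⬝ᵥ fval (weakGrad T π j K v).1 x := fun K v =>
    (continuous_fval _).dotProduct (continuous_fval _)
  refine ⟨LinearMap.mk₂ ℝ (fun u v => T.energyForm π j 𝔸 u v) hadd hsmul (fun u v v' => ?_)
    (fun c u v => ?_), fun u v => rfl, hsymm, fun v => ?_, fun v => ?_⟩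
  · rw [hsymm, hadd, hsymm v, hsymm v']
  · rw [hsymm, hsmul, hsymm v]
  · rw [LinearMap.mk₂_apply, heq, gradNormSq, Finset.mul_sum]
    refine Finset.sum_le_sum fun K _ => ?_
    rw [gradSq, ← integral_const_mul]
    refine integral_mono (integrableOn_hull _ (continuous_const.mul (hgrad K v)))
      (integrableOn_hull _ (hcont K _ _)) fun x => ?_
    change _ ≤ _ ⬝ᵥ _
    rw [dotProduct_comm ((B K).mulVec _)]
    exact (hBb K _).1
  · rw [LinearMap.mk₂_apply, heq, gradNormSq, Finset.mul_sum]
    refine Finset.sum_le_sum fun K _ => ?_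
    rw [gradSq, ← integral_const_mul]
    refine integral_mono (integrableOn_hull _ (hcont K _ _))
      (integrableOn_hull _ (continuous_const.mul (hgrad K v))) fun x => ?_
    change _ ⬝ᵥ _ ≤ _
    rw [dotProduct_comm ((B K).mulVec _)]
    exact (hBb K _).2

lemma gradNormSq_nonneg (v : T.WeakFun π j) : 0 ≤ T.gradNormSq v :=
  Finset.sum_nonneg fun K _ => T.gradSq_nonneg K v

lemma facePart_of_mem_V0 {v : T.WeakFun π j} (hv : v ∈ T.V0 π j) (e : T.Face) :
    facePart e v = 0 := by
  have := (Submodule.mem_inf.1 hv).2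
  rw [Submodule.mem_iInf] at this
  exact this e

end Mesh

end Global

end WeakGalerkin

namespace WeakGalerkin

/-! ### Summation of the local estimates over the mesh. -/

section Global

variable {d : ℕ} {Ω : Set (EuclideanSpace ℝ (Fin d))}

/-- `‖∇_w v‖² ≤ C h⁻² ((v, v))`. -/
lemma exists_gradNormSq_le (hd : 0 < d) (π : Pair) (j : ℕ) {σ τ : ℝ} (hσ : 0 < σ) (hτ : 0 < τ) :
    ∃ C : ℝ, 0 < C ∧ ∀ (Ω : Set (EuclideanSpace ℝ (Fin d))) (T : Mesh Ω), T.ShapeRegular σ →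
      T.QuasiUniform τ → ∀ v : T.WeakFun π j,
        T.size ^ 2 * T.gradNormSq v ≤ C * T.discreteInner v v := by
  obtain ⟨C, hC, h⟩ := exists_gradSq_le (d := d) π j (R := 2 * σ) (by positivity)
  refine ⟨(2 * σ * τ) ^ 2 * C, by positivity, fun Ω T hσT hτT v => ?_⟩
  rw [Mesh.gradNormSq, Mesh.discreteInner_self, Finset.mul_sum, Finset.mul_sum]
  refine Finset.sum_le_sum fun K _ => ?_
  obtain ⟨x₀, r, hK, hr1, hr2⟩ := T.exists_comparable hd hτ hσT hτT K
  have hr := hK.pos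
  have hG := T.gradSq_nonneg K v
  have hJ : 0 ≤ ∑ e ∈ T.bdry K, T.jumpSq K e v :=
    Finset.sum_nonneg fun e _ => T.jumpSq_nonneg K e v
  calc T.size ^ 2 * T.gradSq K v ≤ (2 * σ * τ * r) ^ 2 * T.gradSq K v :=
        mul_le_mul_of_nonneg_right (pow_le_pow_left₀ (hr.le.trans hr2) hr1 2) hG
    _ = (2 * σ * τ) ^ 2 * (r ^ 2 * T.gradSq K v) := by ring
    _ ≤ (2 * σ * τ) ^ 2 * (C * (T.cellSq K v + r * ∑ e ∈ T.bdry K, T.jumpSq K e v)) :=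
        mul_le_mul_of_nonneg_left (h Ω T K x₀ r hK v) (sq_nonneg _)
    _ ≤ (2 * σ * τ) ^ 2 * (C * (T.cellSq K v + T.size * ∑ e ∈ T.bdry K, T.jumpSq K e v)) := by
        gcongr
    _ = _ := by ring

/-- `((v, v)) ≤ C h² ‖∇_w v‖²` for weak functions without boundary part. -/
lemma exists_discreteInner_le (hd : 0 < d) (π : Pair) (j : ℕ) {σ τ : ℝ} (hσ : 0 < σ)
    (hτ : 0 < τ) :
    ∃ C : ℝ, 0 < C ∧ ∀ (Ω : Set (EuclideanSpace ℝ (Fin d))) (T : Mesh Ω), T.ShapeRegular σ →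
      T.QuasiUniform τ → ∀ v : T.WeakFun π j, (∀ e, Mesh.facePart e v = 0) →
        T.discreteInner v v ≤ C * (T.size ^ 2 * T.gradNormSq v) := by
  obtain ⟨C, hC, h⟩ := exists_cellSq_le (d := d) π hd j (R := 2 * σ) (by positivity)
  obtain ⟨C', hC', h'⟩ := exists_trace_le (d := d) j (R := 2 * σ) (by positivity)
  refine ⟨(1 + 2 ^ (d + 1) * (2 * σ * τ * C')) * C, by positivity, fun Ω T hσT hτT v hv => ?_⟩
  rw [Mesh.gradNormSq, Mesh.discreteInner_self, Finset.mul_sum, Finset.mul_sum]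
  refine Finset.sum_le_sum fun K _ => ?_
  obtain ⟨x₀, r, hK, hr1, hr2⟩ := T.exists_comparable hd hτ hσT hτT K
  have hr := hK.pos
  have hG := T.gradSq_nonneg K v
  have hN := T.cellSq_nonneg K v
  have hJ : ∀ e ∈ T.bdry K, T.size * T.jumpSq K e v ≤ 2 * σ * τ * C' * T.cellSq K v := by
    intro e he
    have h1 : T.jumpSq K e v = ∫ x : hull e.1, pval (Mesh.cellPart K v) x ^ 2 ∂μHE[d - 1] := by
      simp [Mesh.jumpSq, hv e]
    have h2 : r * T.jumpSq K e v ≤ C' * T.cellSq K v := by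
      rw [h1]; exact h' Ω T K x₀ r hK e he _ (Mesh.cellPart_mem K v)
    calc T.size * T.jumpSq K e v ≤ 2 * σ * τ * r * T.jumpSq K e v :=
          mul_le_mul_of_nonneg_right hr1 (T.jumpSq_nonneg K e v)
      _ = 2 * σ * τ * (r * T.jumpSq K e v) := by ring
      _ ≤ 2 * σ * τ * (C' * T.cellSq K v) := mul_le_mul_of_nonneg_left h2 (by positivity)
      _ = _ := by ring
  have hsum : T.size * ∑ e ∈ T.bdry K, T.jumpSq K e v ≤
      2 ^ (d + 1) * (2 * σ * τ * C' * T.cellSq K v) := by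
    rw [Finset.mul_sum]
    refine (Finset.sum_le_card_nsmul _ _ _ hJ).trans ?_
    rw [nsmul_eq_mul]
    exact mul_le_mul_of_nonneg_right (by exact_mod_cast T.card_bdry_le K) (by positivity)
  have hcell : T.cellSq K v ≤ C * (T.size ^ 2 * T.gradSq K v) :=
    (h Ω T K x₀ r hK v fun e _ => hv e).trans (by gcongr)
  calc T.cellSq K v + T.size * ∑ e ∈ T.bdry K, T.jumpSq K e v
      ≤ T.cellSq K v + 2 ^ (d + 1) * (2 * σ * τ * C' * T.cellSq K v) := by gcongr
    _ = (1 + 2 ^ (d + 1) * (2 * σ * τ * C')) * T.cellSq K v := by ring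
    _ ≤ (1 + 2 ^ (d + 1) * (2 * σ * τ * C')) * (C * (T.size ^ 2 * T.gradSq K v)) :=
        mul_le_mul_of_nonneg_left hcell (by positivity)
    _ = _ := by ring

/-- `((u, u)) ≤ C h² ‖∇_w v‖²` if `u = {0, u_b}` is the indicator of an edge/face and
`v_b = u_b`. -/
lemma exists_discreteInner_indicator_le (hd : 0 < d) (π : Pair) (j : ℕ) {σ τ : ℝ} (hσ : 0 < σ)
    (hτ : 0 < τ) :
    ∃ C : ℝ, 0 < C ∧ ∀ (Ω : Set (EuclideanSpace ℝ (Fin d))) (T : Mesh Ω), T.ShapeRegular σ →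
      T.QuasiUniform τ → ∀ (e : T.Face) (u v : T.WeakFun π j), (∀ K, Mesh.cellPart K u = 0) →
        (∀ x, (Mesh.facePart e u).1 x = 1) → (∀ e', e' ≠ e → Mesh.facePart e' u = 0) →
        (∀ e', Mesh.facePart e' v = Mesh.facePart e' u) →
        T.discreteInner u u ≤ C * (T.size ^ 2 * T.gradNormSq v) := by
  obtain ⟨C, hC, h⟩ := exists_area_le (d := d) π j (R := 2 * σ) (by positivity)
  refine ⟨C, hC, fun Ω T hσT hτT e u v hu hu1 hu0 huv => ?_⟩
  rw [Mesh.gradNormSq, Mesh.discreteInner_self, Finset.mul_sum, Finset.mul_sum]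
  refine Finset.sum_le_sum fun K _ => ?_
  obtain ⟨x₀, r, hK, -, hr⟩ := T.exists_comparable hd hτ hσT hτT K
  have hr0 := hK.pos
  have hs : 0 ≤ T.size := hr0.le.trans hr
  have hG := T.gradSq_nonneg K v
  have hcell : T.cellSq K u = 0 := by simp [Mesh.cellSq, hu K, pval]
  have hJ0 : ∀ e' ∈ T.bdry K, e' ≠ e → T.jumpSq K e' u = 0 := fun e' _ hne => by
    simp [Mesh.jumpSq, hu K, hu0 e' hne, pval]
  rw [hcell, zero_add]
  -- Only elements having `e` as a face contribute to `D(u,u)`, each with `h` times the area of `e`.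
  by_cases he : e ∈ T.bdry K
  · have hJ : T.jumpSq K e u = T.area e := by
      simp [Mesh.jumpSq, hu K, hu1, pval, Mesh.area]
    rw [Finset.sum_eq_single_of_mem e he hJ0, hJ]
    have h1 := h Ω T K x₀ r hK e he v (fun x => by rw [huv e]; exact hu1 x)
      fun e' _ hne => by rw [huv e', hu0 e' hne]
    calc T.size * T.area e ≤ T.size * (C * (r * T.gradSq K v)) :=
          mul_le_mul_of_nonneg_left h1 hs
      _ ≤ T.size * (C * (T.size * T.gradSq K v)) := by gcongr
      _ = _ := by ring
  · rw [Finset.sum_eq_zero fun e' he' => hJ0 e' he' fun h => he (h ▸ he'), mul_zero]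
    positivity

namespace Mesh

/-- The indicator of an interior edge/face belongs to `V_b`. -/
lemma exists_indicator_mem_Vb (T : Mesh Ω) (π : Pair) (j : ℕ) (e : T.Face)
    (he : ¬ hull e.1 ⊆ frontier Ω) :
    ∃ u ∈ T.Vb π j, (∀ K, cellPart K u = 0) ∧ (∀ x, (facePart e u).1 x = 1) ∧
      ∀ e', e' ≠ e → facePart e' u = 0 := by
  classical
  have h1 : (fun _ => 1 : hull e.1 → ℝ) ∈ polyOn (π.faceDegree j) (hull e.1) := by
    refine ⟨1, ?_, ?_⟩
    · rw [SetLike.mem_coe, MvPolynomial.mem_restrictTotalDegree, MvPolynomial.totalDegree_one]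
      exact Nat.zero_le _
    · ext x
      simp [restrictTo, pval]
  let u : T.WeakFun π j := (0, Pi.single e ⟨_, h1⟩)
  have hu : ∀ K, cellPart K u = 0 := fun K => rfl
  have hu1 : facePart e u = ⟨_, h1⟩ := Pi.single_eq_same e _
  have hu0 : ∀ e', e' ≠ e → facePart e' u = 0 := fun e' hne => Pi.single_eq_of_ne hne _
  refine ⟨u, Submodule.mem_inf.2 ⟨fun e' he' => hu0 e' ?_, ?_⟩, hu, fun x => by rw [hu1], hu0⟩
  · rintro rfl
    exact he he'
  · rw [Submodule.mem_iInf]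
    exact hu

end Mesh

end Global

end WeakGalerkin

/-! ### The two-sided bound for the spectral radius. -/

theorem mainTheorem4 {d : ℕ} (hd : d = 2 ∨ d = 3) (π : WeakGalerkin.Pair) (j : ℕ)
    (α β σ τ : ℝ) (hα : 0 < α) (hβ : 0 < β) (hσ : 0 < σ) (hτ : 0 < τ) :
    ∃ c C : ℝ, 0 < c ∧ 0 < C ∧
      ∀ (Ω : Set (EuclideanSpace ℝ (Fin d))), IsOpen Ω → IsConnected Ω →
      ∀ (T : WeakGalerkin.Mesh Ω), T.ShapeRegular σ → T.QuasiUniform τ → T.HasInteriorVertex →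
      ∀ (𝔸 : EuclideanSpace ℝ (Fin d) → Matrix (Fin d) (Fin d) ℝ),
        WeakGalerkin.IsDiffusion Ω α β 𝔸 → T.IsPiecewiseConstant 𝔸 →
        (∃! P, T.IsEnergyProjector π j 𝔸 P) ∧
        (∃! B, T.IsReducedOperator π j 𝔸 B) ∧
        ENNReal.ofReal (c * (T.size ^ 2)⁻¹) ≤ spectralRadius ℝ (T.reducedOperator π j 𝔸) ∧
        spectralRadius ℝ (T.reducedOperator π j 𝔸) ≤ ENNReal.ofReal (C * (T.size ^ 2)⁻¹) := by
  have hd2 : 2 ≤ d := by omega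
  have hd0 : 0 < d := by omega
  obtain ⟨C₁, hC₁, h₁⟩ := WeakGalerkin.exists_gradNormSq_le hd0 π j hσ hτ
  obtain ⟨C₂, hC₂, h₂⟩ := WeakGalerkin.exists_discreteInner_le hd0 π j hσ hτ
  obtain ⟨C₃, hC₃, h₃⟩ := WeakGalerkin.exists_discreteInner_indicator_le hd0 π j hσ hτ
  -- `D(v,v) ≤ 2 D(u,u) + 2 D(w,w)` and `D(w,w) ≤ C₂ (β C₁ / α) D(u,u)` give the first factor;
  -- `D(u,u) ≤ (C₃ / α) h² a(v,v)` gives the second.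
  set M : ℝ := (2 + 2 * (C₂ * (β * C₁ / α))) * (C₃ / α) with hM
  have hMpos : 0 < M := by positivity
  refine ⟨M⁻¹, β * C₁, by positivity, by positivity,
    fun Ω hΩ _ T hσT hτT hvert 𝔸 hA hpc => ?_⟩
  -- The interior vertex is used twice: the mesh has an element, so `h > 0`, and `e` carries the
  -- test function.
  obtain ⟨K, e, -, he⟩ := T.exists_interior_face hd2 hΩ hvert
  obtain ⟨x₀, r, hK, -, hrs⟩ := T.exists_comparable hd0 hτ hσT hτT K
  have hs : 0 < T.size := hK.pos.trans_le hrs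
  obtain ⟨a, ha, hasymm, halow, haup⟩ := T.exists_energyForm_eq π j hA hpc
  obtain ⟨D, hD, hDsymm⟩ := T.exists_discreteInner_eq π j
  have hDpos : ∀ u, u ≠ 0 → 0 < D u u := fun u hu => by
    rw [← hD]; exact T.discreteInner_pos hΩ hs hu
  have hann : ∀ u, 0 ≤ a u u := fun u =>
    (mul_nonneg hα.le (WeakGalerkin.Mesh.gradNormSq_nonneg u)).trans (halow u)
  have hgrad : ∀ u, T.gradNormSq u ≤ a u u / α := fun u => by
    rw [le_div_iff₀ hα, mul_comm]; exact halow u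
  have hup : ∀ u, a u u ≤ β * C₁ * (T.size ^ 2)⁻¹ * D u u := fun u => by
    have h := h₁ Ω T hσT hτT u
    rw [hD] at h
    have h' : T.gradNormSq u ≤ C₁ * D u u / T.size ^ 2 := by
      rw [le_div_iff₀ (by positivity), mul_comm]; exact h
    calc a u u ≤ β * T.gradNormSq u := haup u
      _ ≤ β * (C₁ * D u u / T.size ^ 2) := mul_le_mul_of_nonneg_left h' hβ.le
      _ = _ := by rw [div_eq_mul_inv]; ring
  have hP : ∃! P, T.IsEnergyProjector π j 𝔸 P := by
    have h := LinearMap.existsUnique_represent (a.domRestrict₁₂ (T.V0 π j) (T.V0 π j))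
      (fun u hu => ?_) (a.domRestrict₁₂ (T.Vb π j) (T.V0 π j))
    · simp only [WeakGalerkin.Mesh.IsEnergyProjector, ha]
      exact h
    -- Zero energy on `V_0` forces zero weak gradient, and then the discrete Poincaré inequality
    -- leaves no room for `D(u,u) > 0`.
    · by_contra hne
      have h0 : a u.1 u.1 = 0 := hu
      have h4 := h₂ Ω T hσT hτT u.1 (WeakGalerkin.Mesh.facePart_of_mem_V0 u.2)
      have h5 := hgrad u.1
      rw [h0, zero_div] at h5
      have h6 : T.gradNormSq u.1 = 0 := le_antisymm h5 (WeakGalerkin.Mesh.gradNormSq_nonneg _)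
      rw [h6, mul_zero, mul_zero, hD] at h4
      exact absurd (hDpos u.1 fun h => hne (Subtype.ext h)) (not_lt.2 h4)
  have hB : ∃! B, T.IsReducedOperator π j 𝔸 B := by
    have h := LinearMap.existsUnique_represent
      (D.domRestrict₁₂ (T.Vr π j 𝔸) (T.Vr π j 𝔸)) (fun u hu => ?_)
      (a.domRestrict₁₂ (T.Vr π j 𝔸) (T.Vr π j 𝔸))
    · simp only [WeakGalerkin.Mesh.IsReducedOperator, ha, hD]
      exact h
    · by_contra hne
      exact (hDpos u.1 fun h => hne (Subtype.ext h)).ne' hu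
  -- Existence rules out the default value `0` in the definition of `P0`, and likewise for
  -- `reducedOperator` below.
  have hP0 : T.IsEnergyProjector π j 𝔸 (T.P0 π j 𝔸) := by
    rw [WeakGalerkin.Mesh.P0, dif_pos hP.exists]
    exact hP.exists.choose_spec
  have hAr : T.IsReducedOperator π j 𝔸 (T.reducedOperator π j 𝔸) := by
    rw [WeakGalerkin.Mesh.reducedOperator, dif_pos hB.exists]
    exact hB.exists.choose_spec
  set A := T.reducedOperator π j 𝔸
  have hAD : ∀ u v : T.Vr π j 𝔸, D (A u).1 v.1 = a u.1 v.1 := fun u v => by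
    rw [← hD, ← ha]; exact hAr u v
  refine ⟨hP, hB, ?_, ?_⟩
  · obtain ⟨u, huV, hu, hu1, hu0⟩ := T.exists_indicator_mem_Vb π j e he
    set w := T.P0 π j 𝔸 ⟨u, huV⟩ with hw
    have hwf := WeakGalerkin.Mesh.facePart_of_mem_V0 w.2
    have hvf : ∀ e', WeakGalerkin.Mesh.facePart e' (u - w.1) =
        WeakGalerkin.Mesh.facePart e' u := fun e' => by rw [map_sub, hwf, sub_zero]
    have hvr : u - w.1 ∈ T.Vr π j 𝔸 := ⟨⟨u, huV⟩, rfl⟩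
    have horth : a w.1 w.1 = a u w.1 := by
      rw [← ha, ← ha]; exact hP0 ⟨u, huV⟩ w
    -- Pythagoras: by orthogonality `a(u - w, u - w) = a(u,u) - a(w,w)`, which is non-negative.
    have hle : a w.1 w.1 ≤ a u u := by
      have h := hann (u - w.1)
      simp only [map_sub, LinearMap.sub_apply] at h
      rw [hasymm w.1 u] at h
      linarith
    have hDw : D w.1 w.1 ≤ C₂ * (β * C₁ / α) * D u u := by
      rw [← hD w.1 w.1]
      refine (h₂ Ω T hσT hτT w.1 hwf).trans ?_
      have h5 : T.size ^ 2 * T.gradNormSq w.1 ≤ β * C₁ / α * D u u := by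
        calc T.size ^ 2 * T.gradNormSq w.1
            ≤ T.size ^ 2 * (β * C₁ * (T.size ^ 2)⁻¹ * D u u / α) :=
              mul_le_mul_of_nonneg_left ((hgrad w.1).trans
                (div_le_div_of_nonneg_right (hle.trans (hup u)) hα.le)) (sq_nonneg _)
          _ = _ := by field_simp
      exact (mul_le_mul_of_nonneg_left h5 hC₂.le).trans_eq (by ring)
    have hDu : D u u ≤ C₃ / α * (T.size ^ 2 * a (u - w.1) (u - w.1)) := by
      rw [← hD]
      refine (h₃ Ω T hσT hτT e u (u - w.1) hu hu1 hu0 hvf).trans ?_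
      calc C₃ * (T.size ^ 2 * T.gradNormSq (u - w.1))
          ≤ C₃ * (T.size ^ 2 * (a (u - w.1) (u - w.1) / α)) := by gcongr; exact hgrad _
        _ = _ := by ring
    -- Parallelogram identity, with the term `D(u + w, u + w)` dropped.
    have hDv : D (u - w.1) (u - w.1) ≤ 2 * D u u + 2 * D w.1 w.1 := by
      have h : 0 ≤ D (u + w.1) (u + w.1) := by
        rcases eq_or_ne (u + w.1) 0 with h | h
        · simp [h]
        · exact (hDpos _ h).le
      simp only [map_sub, map_add, LinearMap.sub_apply, LinearMap.add_apply] at h ⊢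
      linarith
    -- Subtracting `w` does not change the face parts, and on `e` the value is still `1`.
    have hv0 : (⟨u - w.1, hvr⟩ : T.Vr π j 𝔸) ≠ 0 := by
      intro h
      obtain ⟨p, hp⟩ := T.nonempty_of_mem_faces e.2.1
      have h6 : u - w.1 = 0 := congrArg Subtype.val h
      have h7 := hvf e
      rw [h6, map_zero] at h7
      have h8 := hu1 ⟨p, subset_convexHull ℝ _ hp⟩
      rw [← h7] at h8
      exact zero_ne_one h8
    refine LinearMap.le_spectralRadius_of_rayleigh
      (D.domRestrict₁₂ (T.Vr π j 𝔸) (T.Vr π j 𝔸)) (fun u v => hDsymm _ _)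
      (fun u hu => hDpos u.1 fun h => hu (Subtype.ext h)) A (fun u v => ?_) hv0 ?_
    · change D (A u).1 v.1 = D u.1 (A v).1
      rw [hAD, hDsymm, hAD, hasymm]
    · change M⁻¹ * (T.size ^ 2)⁻¹ * D (u - w.1) (u - w.1) ≤ D (A ⟨u - w.1, hvr⟩).1 (u - w.1)
      rw [hAD ⟨u - w.1, hvr⟩ ⟨u - w.1, hvr⟩, mul_assoc, inv_mul_le_iff₀ hMpos,
        inv_mul_le_iff₀ (by positivity)]
      calc D (u - w.1) (u - w.1) ≤ 2 * D u u + 2 * (C₂ * (β * C₁ / α) * D u u) := by linarith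
        _ = (2 + 2 * (C₂ * (β * C₁ / α))) * D u u := by ring
        _ ≤ (2 + 2 * (C₂ * (β * C₁ / α))) *
            (C₃ / α * (T.size ^ 2 * a (u - w.1) (u - w.1))) := by gcongr
        _ = _ := by rw [hM]; ring
  · refine LinearMap.spectralRadius_le_of_rayleigh
      (D.domRestrict₁₂ (T.Vr π j 𝔸) (T.Vr π j 𝔸))
      (fun u hu => hDpos u.1 fun h => hu (Subtype.ext h)) A (fun u => ?_) fun u => ?_
    · change 0 ≤ D (A u).1 u.1
      rw [hAD]
      exact hann _
    · change D (A u).1 u.1 ≤ β * C₁ * (T.size ^ 2)⁻¹ * D u.1 u.1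
      rw [hAD]
      exact hup _
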